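/- For $n\ge 0$ and $\alpha\in\mathbf N^n$ let $h_\alpha$ be the $L^2$-normalized Hermite function on $\mathbf R^n$, $$h_\alpha(x)=\pi^{-n/4}(-1)^{|\alpha|}(2^{|\alpha|}\alpha!)^{-1/2}e^{|x|^2/2}\,\partial^\alpha\big(e^{-|x|^2}\big),\qquad |\alpha|=\alpha_1+\cdots+\alpha_n .$$ For $s>0$ let $\mathcal H_s(\mathbf R^n)$ (respectively $\mathcal H_{0,s}(\mathbf R^n)$) be the set of all functions $f=\sum_{\alpha\in\mathbf N^n}c_\alpha h_\alpha$ on $\mathbf R^n$ whose coefficients $c_\alpha\in\mathbf C$ satisfy, for some $r>0$ (respectively for every $r>0$), $$\sup_{\alpha\in\mathbf N^n}|c_\alpha|\,e^{r|\alpha|^{1/(2s)}}<\infty .$$ For a real $d\times d$ matrix $A$ and a rapidly decreasing symbol $a$ on $\mathbf R^{2d}=\mathbf R^d\times\mathbf R^d$, let $\operatorname{Op}_A(a)$ be the operator on the Schwartz space $\mathscr S(\mathbf R^d)$ given by $$\operatorname{Op}_A(a)f(x)=(2\pi)^{-d}\iint_{\mathbf R^{2d}}a(x-A(x-y),\xi)\,f(y)\,e^{i\langle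 x-y,\xi\rangle}\,dy\,d\xi ,$$ and write $a=a_1\#_Aa_2$ if $\operatorname{Op}_A(a)=\operatorname{Op}_A(a_1)\circ\operatorname{Op}_A(a_2)$ on $\mathscr S(\mathbf R^d)$. **Theorem.** Let $A$ be a real $d\times d$ matrix, $s_1\ge\frac12$ and $s_2>\frac12$. Then the following is true: 1. if $a\in\mathcal H_{s_1}(\mathbf R^{2d})$, then there are $a_1,a_2\in\mathcal H_{s_1}(\mathbf R^{2d})$ such that $a=a_1\#_Aa_2$; 2. if $a\in\mathcal H_{0,s_2}(\mathbf R^{2d})$, then there are $a_1,a_2\in\mathcal H_{0,s_2}(\mathbf R^{2d})$ such that $a=a_1\#_Aa_2$. -/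

import Mathlib

noncomputable section

namespace Pilipovic

/-- The `L²`-normalized Hermite function of order `n` on the real line,
`h_n(x) = π^{-1/4} (n!)^{-1/2} He_n(√2 x) e^{-x²/2}`, where `He_n = Polynomial.hermite n` is the
probabilists' Hermite polynomial. Since `H_n(x) = 2^{n/2} He_n(√2 x)`, this is the usual
`π^{-1/4} (2^n n!)^{-1/2} H_n(x) e^{-x²/2} = (-1)^n π^{-1/4} (2^n n!)^{-1/2} e^{x²/2} ∂ⁿ e^{-x²}`. -/
def hermiteFun (n : ℕ) (x : ℝ) : ℝ :=
  Real.pi ^ (-(1 / 4) : ℝ) / Real.sqrt (n.factorial : ℝ) *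
    Polynomial.aeval (Real.sqrt 2 * x) (Polynomial.hermite n) * Real.exp (-(x ^ 2 / 2))

/-- The Hermite function `h_α` on `ℝ^ι`, with multi-index `α ∈ ℕ^ι`. -/
def hermiteFunction {ι : Type*} [Fintype ι] (α : ι → ℕ) (x : ι → ℝ) : ℝ :=
  ∏ i, hermiteFun (α i) (x i)

/-- `|c_α| ≤ C e^{-r |α|^{1/(2s)}}` for some constant `C`, where `|α| = ∑ i, α i`. -/
def HasDecay {ι : Type*} [Fintype ι] (s r : ℝ) (c : (ι → ℕ) → ℂ) : Prop :=
  ∃ C : ℝ, ∀ α : ι → ℕ, ‖c α‖ ≤ C * Real.exp (-(r * ((∑ i, α i : ℕ) : ℝ) ^ (1 / (2 * s))))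

/-- `f` is the (pointwise, absolutely convergent) sum of the Hermite series `∑ c_α h_α`. -/
def IsHermiteSeries {ι : Type*} [Fintype ι] (c : (ι → ℕ) → ℂ) (f : (ι → ℝ) → ℂ) : Prop :=
  ∀ x : ι → ℝ, HasSum (fun α : ι → ℕ => c α * (hermiteFunction α x : ℂ)) (f x)

/-- The Pilipović space `𝓗_s(ℝ^ι)` of Roumieu type, of order `s > 0`: Hermite series whose
coefficients are `O(e^{-r |α|^{1/(2s)}})` for some `r > 0`. -/
def roumieu (ι : Type*) [Fintype ι] (s : ℝ) : Set ((ι → ℝ) → ℂ) :=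
  {f | ∃ c : (ι → ℕ) → ℂ, (∃ r : ℝ, 0 < r ∧ HasDecay s r c) ∧ IsHermiteSeries c f}

/-- The Pilipović space `𝓗_{0,s}(ℝ^ι)` of Beurling type, of order `s > 0`: Hermite series whose
coefficients are `O(e^{-r |α|^{1/(2s)}})` for every `r > 0`. -/
def beurling (ι : Type*) [Fintype ι] (s : ℝ) : Set ((ι → ℝ) → ℂ) :=
  {f | ∃ c : (ι → ℕ) → ℂ, (∀ r : ℝ, 0 < r → HasDecay s r c) ∧ IsHermiteSeries c f}

/-- The pseudo-differential operator `Op_A(a)` with symbol `a(x, ξ)` on `ℝ^{2d} = ℝ^d × ℝ^d`,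
`Op_A(a) f(x) = (2π)^{-d} ∬ a(x - A(x - y), ξ) f(y) e^{i⟨x - y, ξ⟩} dξ dy`.
For `a` and `f` rapidly decreasing the integrals converge absolutely. -/
def Op {d : ℕ} (A : Matrix (Fin d) (Fin d) ℝ) (a : (Fin d ⊕ Fin d → ℝ) → ℂ)
    (f : (Fin d → ℝ) → ℂ) (x : Fin d → ℝ) : ℂ :=
  ((2 * Real.pi : ℝ) : ℂ)⁻¹ ^ d *
    ∫ y : Fin d → ℝ, ∫ ξ : Fin d → ℝ,
      a (Sum.elim (x - A.mulVec (x - y)) ξ) * f y *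
        Complex.exp (Complex.I * (((x - y) ⬝ᵥ ξ : ℝ) : ℂ))

/-- `a = a₁ #_A a₂`, that is, `Op_A(a) = Op_A(a₁) ∘ Op_A(a₂)` as operators on the Schwartz space
of `ℝ^d`. -/
def IsSharp {d : ℕ} (A : Matrix (Fin d) (Fin d) ℝ)
    (a a₁ a₂ : (Fin d ⊕ Fin d → ℝ) → ℂ) : Prop :=
  ∀ f : SchwartzMap (Fin d → ℝ) ℂ, Op A a f = Op A a₁ (Op A a₂ f)

end Pilipovic

end

/-! `Op A a` is the integral operator whose kernel is a constant times the partial Fourier transform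
of `a` in `ξ`, evaluated at `(x - A(x - y), x - y)`. The partial Fourier transform multiplies
Hermite coefficients by powers of `I`, and the substitution is an invertible linear map. If the
spaces are stable under such maps, symbols may be replaced by kernels (`IsDecayClass.exists_kernel`,
`IsDecayClass.exists_symbol`).

The coefficients of a kernel form a matrix indexed by pairs of multi-indices, and composition
becomes matrix multiplication by orthonormality. The matrix `c` is factored by hand: the right
factor is diagonal with entry `sup_{|α| ≥ |γ|} |c_α|^{1/2}` at `γ`, and the left factor is the
quotient. Since `|α|` is at least the length of its second half, the quotient is at most
`|c_α|^{1/2}`; both factors decay like `c`, with the rate multiplied by a fixed constant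
(`norm_leftFactor_le`, `hasDecay_rightFactor`, `integral_kernel_comp`).

The analytic work is stability under `x ↦ B x`. The coefficients `T(α, β) = ∫ h_α(Bx) h_β(x) dx` are
uniformly bounded and are `O(2^{|α|} e^{-κ|β|})` (`exists_abs_transfer_le`), by iterating ladder
relations. Splitting at `|α| = κ|β|/2` turns these two bounds into decay of the new coefficients
(`norm_transferCoeff_le`). The new terms `e^{-κ|β|/2}` are admissible at some rate when `1/(2s) ≤
1`, and at every rate when `1/(2s) < 1`, whence the two ranges of `s`. -/

namespace Pilipovic

open MeasureTheory

/-! ### Hermite functions on the line: recurrences, orthonormality, polynomial bounds, Fourier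
transform. -/

section HermiteFun

open Polynomial

lemma derivative_hermite_succ (n : ℕ) :
    derivative (hermite (n + 1)) = ((n : ℤ[X]) + 1) * hermite n := by
  induction n with
  | zero => simp
  | succ n ih =>
    have h1 := hermite_succ (n + 1)
    have h2 := hermite_succ n
    rw [h1, derivative_sub, derivative_mul, ih, derivative_mul]
    simp only [derivative_X, derivative_add, derivative_natCast, derivative_one]
    push_cast
    linear_combination (-(n : ℤ[X]) - 1) * h2

lemma derivative_hermite (n : ℕ) :
    derivative (hermite n) = (n : ℤ[X]) * hermite (n - 1) := by
  cases n with
  | zero => simp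
  | succ n => simpa using derivative_hermite_succ n

lemma sqrt_factorial_succ (n : ℕ) :
    Real.sqrt ((n + 1).factorial : ℝ) = Real.sqrt (n + 1) * Real.sqrt (n.factorial : ℝ) := by
  rw [Nat.factorial_succ, Nat.cast_mul, Real.sqrt_mul (by positivity)]
  push_cast
  rfl

/-- The truncated index `n - 1` is harmless here and below: at `n = 0` its coefficient `√n`
vanishes. -/
lemma sqrt_mul_hermiteFun_pred (n : ℕ) (x : ℝ) :
    Real.sqrt n * hermiteFun (n - 1) x =
      Real.pi ^ (-(1 / 4) : ℝ) / Real.sqrt (n.factorial : ℝ) *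
        (n * Polynomial.aeval (Real.sqrt 2 * x) (Polynomial.hermite (n - 1))) *
          Real.exp (-(x ^ 2 / 2)) := by
  cases n with
  | zero => simp
  | succ n =>
    unfold hermiteFun
    rw [sqrt_factorial_succ]
    have h1 : (0 : ℝ) < Real.sqrt (n + 1) := by positivity
    have h2 : (0 : ℝ) < Real.sqrt (n.factorial : ℝ) := by positivity
    have h3 : Real.sqrt ((n : ℝ) + 1) ^ 2 = n + 1 := Real.sq_sqrt (by positivity)
    simp only [Nat.add_sub_cancel]
    push_cast
    field_simp
    linear_combination (aeval (Real.sqrt 2 * x) (hermite n)) * h3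

/-- The three-term recurrence. -/
lemma sqrt_mul_hermiteFun_succ (n : ℕ) (x : ℝ) :
    Real.sqrt (n + 1) * hermiteFun (n + 1) x =
      Real.sqrt 2 * x * hermiteFun n x - Real.sqrt n * hermiteFun (n - 1) x := by
  rw [sqrt_mul_hermiteFun_pred]
  unfold hermiteFun
  rw [sqrt_factorial_succ, hermite_succ, derivative_hermite]
  have h1 : (0 : ℝ) < Real.sqrt (n + 1) := by positivity
  have h2 : (0 : ℝ) < Real.sqrt (n.factorial : ℝ) := by positivity
  simp only [map_sub, map_mul, aeval_X, map_natCast]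
  field_simp

lemma mul_hermiteFun (n : ℕ) (x : ℝ) :
    x * hermiteFun n x =
      (Real.sqrt n * hermiteFun (n - 1) x + Real.sqrt (n + 1) * hermiteFun (n + 1) x) /
        Real.sqrt 2 := by
  rw [sqrt_mul_hermiteFun_succ]
  field_simp
  ring

lemma hasDerivAt_hermiteFun (n : ℕ) (x : ℝ) :
    HasDerivAt (hermiteFun n)
      ((Real.sqrt n * hermiteFun (n - 1) x - Real.sqrt (n + 1) * hermiteFun (n + 1) x) /
        Real.sqrt 2) x := by
  have hp : HasDerivAt (fun x : ℝ => aeval (Real.sqrt 2 * x) (hermite n))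
      (aeval (Real.sqrt 2 * x) (derivative (hermite n)) * Real.sqrt 2) x := by
    have := (Polynomial.hasDerivAt_aeval (hermite n) (Real.sqrt 2 * x)).comp x
      ((hasDerivAt_id x).const_mul (Real.sqrt 2))
    simpa [Function.comp_def] using this
  have he : HasDerivAt (fun x : ℝ => Real.exp (-(x ^ 2 / 2)))
      (Real.exp (-(x ^ 2 / 2)) * (-x)) x := by
    have := (((hasDerivAt_id x).pow 2).div_const 2).neg.exp
    simpa using this
  have h := (hp.const_mul (Real.pi ^ (-(1 / 4) : ℝ) / Real.sqrt (n.factorial : ℝ))).mul he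
  refine (h.congr_deriv ?_ : HasDerivAt (hermiteFun n) _ x)
  have h2 : Real.sqrt 2 ^ 2 = 2 := Real.sq_sqrt (by norm_num)
  rw [sqrt_mul_hermiteFun_succ, sqrt_mul_hermiteFun_pred, eq_div_iff (by positivity)]
  simp only [derivative_hermite, map_mul, map_natCast]
  unfold hermiteFun
  linear_combination (Real.pi ^ (-(1 / 4) : ℝ) / Real.sqrt (n.factorial : ℝ) *
    (n * Polynomial.aeval (Real.sqrt 2 * x) (Polynomial.hermite (n - 1))) *
          Real.exp (-(x ^ 2 / 2))) * h2

lemma continuous_hermiteFun (n : ℕ) : Continuous (hermiteFun n) :=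
  continuous_iff_continuousAt.2 fun x => (hasDerivAt_hermiteFun n x).continuousAt

/-- Half of the Gaussian absorbs the polynomial. The constant is uncontrolled in the degree, so this
serves only for integrability, boundedness and limits at infinity. -/
lemma exists_aeval_mul_exp_le (p : ℤ[X]) :
    ∃ C : ℝ, ∀ x : ℝ, |aeval (Real.sqrt 2 * x) p| * Real.exp (-(x ^ 2 / 4)) ≤ C := by
  induction p using Polynomial.induction_on' with
  | add p q hp hq =>
    obtain ⟨C, hC⟩ := hp
    obtain ⟨D, hD⟩ := hq
    refine ⟨C + D, fun x => ?_⟩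
    rw [map_add]
    calc _ ≤ (|aeval (Real.sqrt 2 * x) p| + |aeval (Real.sqrt 2 * x) q|)
            * Real.exp (-(x ^ 2 / 4)) := by gcongr; exact abs_add_le _ _
      _ ≤ C + D := by rw [add_mul]; exact add_le_add (hC x) (hD x)
  | monomial k a =>
    refine ⟨|(a : ℝ)| * (k.factorial * Real.exp 2), fun x => ?_⟩
    rw [aeval_monomial, abs_mul, mul_assoc]
    simp only [algebraMap_int_eq, eq_intCast]
    refine mul_le_mul_of_nonneg_left ?_ (abs_nonneg _)
    have h1 := Real.pow_div_factorial_le_exp _ (abs_nonneg (Real.sqrt 2 * x)) k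
    rw [div_le_iff₀ (by positivity)] at h1
    -- This is `(|x|/2 - √2)² ≥ 0`.
    have h3 : |Real.sqrt 2 * x| ≤ x ^ 2 / 4 + 2 := by
      have h2 : Real.sqrt 2 ^ 2 = 2 := Real.sq_sqrt (by norm_num)
      rw [abs_le]
      constructor <;> nlinarith [sq_nonneg (x - 2 * Real.sqrt 2), sq_nonneg (x + 2 * Real.sqrt 2)]
    rw [abs_pow]
    calc _ ≤ (Real.exp |Real.sqrt 2 * x| * k.factorial) * Real.exp (-(x ^ 2 / 4)) := by gcongr
      _ ≤ (Real.exp (x ^ 2 / 4 + 2) * k.factorial) * Real.exp (-(x ^ 2 / 4)) := by gcongr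
      _ = _ := by
        rw [Real.exp_add, Real.exp_neg]
        field_simp

lemma exists_abs_hermiteFun_le (n : ℕ) :
    ∃ C : ℝ, ∀ x : ℝ, |hermiteFun n x| ≤ C * Real.exp (-(1 / 4) * x ^ 2) := by
  obtain ⟨C, hC⟩ := exists_aeval_mul_exp_le (hermite n)
  refine ⟨|Real.pi ^ (-(1 / 4) : ℝ) / Real.sqrt (n.factorial : ℝ)| * C, fun x => ?_⟩
  unfold hermiteFun
  have : Real.exp (-(x ^ 2 / 2)) = Real.exp (-(x ^ 2 / 4)) * Real.exp (-(1 / 4) * x ^ 2) := by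
    rw [← Real.exp_add]
    ring_nf
  rw [this, abs_mul, abs_mul, abs_mul, Real.abs_exp, Real.abs_exp]
  calc _ = |Real.pi ^ (-(1 / 4) : ℝ) / Real.sqrt (n.factorial : ℝ)| *
        (|aeval (Real.sqrt 2 * x) (hermite n)| * Real.exp (-(x ^ 2 / 4))) *
          Real.exp (-(1 / 4) * x ^ 2) := by ring
    _ ≤ _ := by
      gcongr
      exact hC x

lemma integrable_hermiteFun (n : ℕ) : Integrable (hermiteFun n) := by
  obtain ⟨C, hC⟩ := exists_abs_hermiteFun_le n
  refine ((integrable_exp_neg_mul_sq (b := 1 / 4) (by norm_num)).const_mul C).mono'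
    (continuous_hermiteFun n).aestronglyMeasurable (Filter.Eventually.of_forall fun x => ?_)
  exact hC x

lemma exists_bound_hermiteFun (n : ℕ) : ∃ C : ℝ, ∀ x, ‖hermiteFun n x‖ ≤ C := by
  obtain ⟨C, hC⟩ := exists_abs_hermiteFun_le n
  refine ⟨|C|, fun x => (hC x).trans ?_⟩
  calc C * Real.exp (-(1 / 4) * x ^ 2) ≤ |C| * 1 := by
        gcongr
        · exact le_abs_self C
        · exact Real.exp_le_one_iff.2 (by nlinarith [sq_nonneg x])
    _ = |C| := mul_one _

lemma integrable_hermiteFun_mul (m n : ℕ) :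
    Integrable (fun x => hermiteFun m x * hermiteFun n x) := by
  obtain ⟨C, hC⟩ := exists_bound_hermiteFun m
  exact (integrable_hermiteFun n).bdd_mul (continuous_hermiteFun m).aestronglyMeasurable
    (Filter.Eventually.of_forall hC)

lemma tendsto_hermiteFun_atBot (n : ℕ) :
    Filter.Tendsto (hermiteFun n) Filter.atBot (nhds 0) := by
  obtain ⟨C, hC⟩ := exists_abs_hermiteFun_le n
  refine squeeze_zero_norm hC ?_
  rw [← mul_zero C]
  refine Filter.Tendsto.const_mul C (Real.tendsto_exp_atBot.comp ?_)
  refine Filter.Tendsto.const_mul_atTop_of_neg (by norm_num) ?_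
  simpa [Function.comp_def] using
    (Filter.tendsto_pow_atTop (α := ℝ) two_ne_zero).comp Filter.tendsto_abs_atBot_atTop

/-- The pairing of two Hermite functions with the annihilation operator moved across. -/
lemma integral_hermiteFun_ladder (m n : ℕ) :
    Real.sqrt (m + 1) * ∫ x, hermiteFun (m + 1) x * hermiteFun n x =
      Real.sqrt n * ∫ x, hermiteFun m x * hermiteFun (n - 1) x := by
  have hi := integrable_hermiteFun_mul
  have h := integral_mul_deriv_eq_deriv_mul_of_integrable
    (u := hermiteFun m) (v := hermiteFun n)
    (fun x _ => hasDerivAt_hermiteFun m x) (fun x _ => hasDerivAt_hermiteFun n x)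
    ?_ ?_ (hi m n)
  -- With `h_n' = √(2n) h_{n-1} - x h_n` and `h_m' = x h_m - √(2(m+1)) h_{m+1}`, the terms
  -- containing `x` cancel in the integration by parts.
  · have e1 : ∀ x, hermiteFun m x * ((Real.sqrt n * hermiteFun (n - 1) x -
        Real.sqrt (n + 1) * hermiteFun (n + 1) x) / Real.sqrt 2) =
        Real.sqrt 2 * Real.sqrt n * (hermiteFun m x * hermiteFun (n - 1) x)
          - x * hermiteFun m x * hermiteFun n x := fun x => by
      have h2 : Real.sqrt 2 ^ 2 = 2 := Real.sq_sqrt (by norm_num)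
      rw [mul_comm x, mul_assoc (hermiteFun m x), mul_hermiteFun]
      field_simp
      linear_combination (-hermiteFun m x * Real.sqrt n * hermiteFun (n - 1) x) * h2
    have e2 : ∀ x, ((Real.sqrt m * hermiteFun (m - 1) x -
        Real.sqrt (m + 1) * hermiteFun (m + 1) x) / Real.sqrt 2) * hermiteFun n x =
        x * hermiteFun m x * hermiteFun n x
          - Real.sqrt 2 * Real.sqrt (m + 1) * (hermiteFun (m + 1) x * hermiteFun n x) := fun x => by
      have h2 : Real.sqrt 2 ^ 2 = 2 := Real.sq_sqrt (by norm_num)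
      rw [mul_hermiteFun]
      field_simp
      linear_combination (Real.sqrt (m + 1) * hermiteFun (m + 1) x * hermiteFun n x) * h2
    have hx : Integrable (fun x => x * hermiteFun m x * hermiteFun n x) := by
      simp_rw [mul_hermiteFun, div_mul_eq_mul_div, add_mul, mul_assoc]
      exact (((hi _ _).const_mul _).add ((hi _ _).const_mul _)).div_const _
    simp_rw [e1, e2] at h
    rw [integral_sub ((hi _ _).const_mul _) hx, integral_sub hx ((hi _ _).const_mul _),
      integral_const_mul, integral_const_mul] at h
    have h0 : (0 : ℝ) < Real.sqrt 2 := by positivity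
    apply mul_left_cancel₀ h0.ne'
    linear_combination -h
  · simp only [Pi.mul_def]
    have := (((hi m (n - 1)).const_mul (Real.sqrt n)).sub
      ((hi m (n + 1)).const_mul (Real.sqrt (n + 1)))).div_const (Real.sqrt 2)
    refine this.congr (Filter.Eventually.of_forall fun x => ?_)
    simp only [Pi.sub_apply]
    ring
  · simp only [Pi.mul_def]
    have := (((hi (m - 1) n).const_mul (Real.sqrt m)).sub
      ((hi (m + 1) n).const_mul (Real.sqrt (m + 1)))).div_const (Real.sqrt 2)
    refine this.congr (Filter.Eventually.of_forall fun x => ?_)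
    simp only [Pi.sub_apply]
    ring

lemma hermiteFun_zero (x : ℝ) :
    hermiteFun 0 x = Real.pi ^ (-(1 / 4) : ℝ) * Real.exp (-(x ^ 2 / 2)) := by
  simp [hermiteFun]

/-- Orthonormality of the Hermite functions on the line. -/
lemma integral_hermiteFun_mul (m n : ℕ) :
    ∫ x, hermiteFun m x * hermiteFun n x = if m = n then 1 else 0 := by
  induction m generalizing n with
  | zero =>
    cases n with
    | zero =>
      have : ∀ x, hermiteFun 0 x * hermiteFun 0 x =
          Real.pi ^ (-(1 / 2) : ℝ) * Real.exp (-1 * x ^ 2) := fun x => by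
        rw [hermiteFun_zero, mul_mul_mul_comm, ← Real.exp_add, ← Real.rpow_add Real.pi_pos]
        congr 2 <;> ring
      simp_rw [this]
      rw [integral_const_mul, integral_gaussian, div_one, Real.sqrt_eq_rpow,
        ← Real.rpow_add Real.pi_pos]
      norm_num
    | succ n =>
      have h := integral_hermiteFun_ladder n 0
      simp only [CharP.cast_eq_zero, Real.sqrt_zero, zero_mul] at h
      have h1 : Real.sqrt ((n : ℝ) + 1) ≠ 0 := by positivity
      simp only [mul_comm (hermiteFun 0 _)]
      simpa [h1] using h
  | succ m ih =>
    have h := integral_hermiteFun_ladder m n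
    have h1 : Real.sqrt ((m : ℝ) + 1) ≠ 0 := by positivity
    rw [ih] at h
    cases n with
    | zero => simpa [h1] using h
    | succ n =>
      simp only [Nat.add_sub_cancel] at h
      by_cases hmn : m = n
      · subst hmn
        simp only [if_true, mul_one] at h ⊢
        push_cast at h
        exact mul_left_cancel₀ h1 (h.trans (mul_one _).symm)
      · simpa [h1, hmn] using h

lemma integral_hermiteFun_sq (n : ℕ) : ∫ x, hermiteFun n x ^ 2 = 1 := by
  simpa [sq] using integral_hermiteFun_mul n n

lemma integrable_hermiteFun_sq (n : ℕ) : Integrable (fun x => hermiteFun n x ^ 2) := by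
  simpa [sq] using integrable_hermiteFun_mul n n

/-- Majorant of the squares of `x h_n` and of `h_n'`. -/
lemma integral_ladder_sq (n : ℕ) :
    ∫ x, (n * hermiteFun (n - 1) x ^ 2 + (n + 1) * hermiteFun (n + 1) x ^ 2) = 2 * (n : ℝ) + 1 := by
  rw [integral_add ((integrable_hermiteFun_sq _).const_mul _)
    ((integrable_hermiteFun_sq _).const_mul _), integral_const_mul, integral_const_mul,
    integral_hermiteFun_sq, integral_hermiteFun_sq]
  ring

lemma integrable_ladder_sq (n : ℕ) : Integrable
    (fun x => n * hermiteFun (n - 1) x ^ 2 + (n + 1) * hermiteFun (n + 1) x ^ 2) :=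
  ((integrable_hermiteFun_sq _).const_mul _).add ((integrable_hermiteFun_sq _).const_mul _)

/-- This is `(u + v)²/2 ≤ u² + v²`. The sign of `b` is free, so it covers both `x h_n` and `h_n'`.
-/
lemma sq_ladder_le (n : ℕ) (a b : ℝ) :
    ((Real.sqrt n * a + Real.sqrt (n + 1) * b) / Real.sqrt 2) ^ 2 ≤
      n * a ^ 2 + (n + 1) * b ^ 2 := by
  have h2 : Real.sqrt 2 ^ 2 = 2 := Real.sq_sqrt (by norm_num)
  have h3 : Real.sqrt (n : ℝ) ^ 2 = n := Real.sq_sqrt (by positivity)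
  have h4 : Real.sqrt ((n : ℝ) + 1) ^ 2 = n + 1 := Real.sq_sqrt (by positivity)
  rw [div_pow, h2]
  have h := sq_nonneg (Real.sqrt n * a - Real.sqrt (n + 1) * b)
  have e : (n : ℝ) * a ^ 2 + (n + 1) * b ^ 2 =
      (Real.sqrt n * a) ^ 2 + (Real.sqrt (n + 1) * b) ^ 2 := by
    rw [mul_pow, mul_pow, h3, h4]
  rw [e]
  linarith

/-- `h_n(x)²` is the integral of `2 h_n h_n'` over `(-∞, x]`, hence at most `∫ h_n² + ∫ h_n'²`,
which the ladder relations bound by `2n + 2`. Only polynomial growth in `n` matters later. -/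
lemma abs_hermiteFun_le (n : ℕ) (x : ℝ) : |hermiteFun n x| ≤ 3 * (n + 1) := by
  set g := fun x => hermiteFun n x ^ 2 +
    (n * hermiteFun (n - 1) x ^ 2 + (n + 1) * hermiteFun (n + 1) x ^ 2) with hg
  have hgi : Integrable g := (integrable_hermiteFun_sq n).add (integrable_ladder_sq n)
  have hgI : ∫ x, g x = 2 * n + 2 := by
    rw [hg, integral_add (integrable_hermiteFun_sq n) (integrable_ladder_sq n),
      integral_hermiteFun_sq, integral_ladder_sq]
    ring
  have hg0 : ∀ x, 0 ≤ g x := fun x => by positivity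
  set g' := fun x => 2 * hermiteFun n x * ((Real.sqrt n * hermiteFun (n - 1) x -
    Real.sqrt (n + 1) * hermiteFun (n + 1) x) / Real.sqrt 2) with hg'
  have hder : ∀ x, HasDerivAt (fun x => hermiteFun n x ^ 2) (g' x) x := fun x => by
    have h := (hasDerivAt_hermiteFun n x).fun_pow 2
    simp only [Nat.cast_ofNat, Nat.add_one_sub_one, pow_one] at h
    exact h
  have hcont : Continuous g' := by
    have h := continuous_hermiteFun
    have h1 := h n
    have h2 := h (n - 1)
    have h3 := h (n + 1)
    fun_prop
  have hle : ∀ x, ‖g' x‖ ≤ g x := fun x => by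
    have h := sq_ladder_le n (hermiteFun (n - 1) x) (-hermiteFun (n + 1) x)
    rw [mul_neg, ← sub_eq_add_neg, neg_sq] at h
    rw [Real.norm_eq_abs, abs_le]
    simp only [hg', hg]
    set d := (Real.sqrt n * hermiteFun (n - 1) x -
      Real.sqrt (n + 1) * hermiteFun (n + 1) x) / Real.sqrt 2
    constructor <;> nlinarith [sq_nonneg (hermiteFun n x + d), sq_nonneg (hermiteFun n x - d)]
  have hg'i : Integrable g' :=
    hgi.mono' hcont.aestronglyMeasurable (Filter.Eventually.of_forall hle)
  have hlim : Filter.Tendsto (fun x => hermiteFun n x ^ 2) Filter.atBot (nhds 0) := by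
    simpa using (tendsto_hermiteFun_atBot n).pow 2
  have hFTC := integral_Iic_of_hasDerivAt_of_tendsto' (a := x) (fun y _ => hder y)
    hg'i.integrableOn hlim
  have hsq : hermiteFun n x ^ 2 ≤ 2 * n + 2 := by
    rw [sub_zero] at hFTC
    rw [← hFTC, ← hgI]
    calc ∫ y in Set.Iic x, g' y ≤ ∫ y in Set.Iic x, g y :=
          setIntegral_mono hg'i.integrableOn hgi.integrableOn
            fun y => (le_abs_self _).trans (hle y)
      _ ≤ ∫ y, g y := setIntegral_le_integral hgi (Filter.Eventually.of_forall hg0)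
  refine abs_le_of_sq_le_sq (hsq.trans ?_) (by positivity)
  nlinarith [(Nat.cast_nonneg n : (0 : ℝ) ≤ n)]

/-- Weighted AM-GM gives `2|h| ≤ (1 + x²)⁻¹ + (1 + x²) h²`, and the second moment is controlled by
the ladder relations. The bound is kept equal to the supremum bound so that one weight serves for
both. -/
lemma integral_abs_hermiteFun_le (n : ℕ) : ∫ x, |hermiteFun n x| ≤ 3 * (n + 1) := by
  have hle : ∀ x, |hermiteFun n x| ≤ (1 / 2) * ((1 + x ^ 2)⁻¹ + (hermiteFun n x ^ 2 +
      (n * hermiteFun (n - 1) x ^ 2 + (n + 1) * hermiteFun (n + 1) x ^ 2))) := fun x => by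
    have h := sq_ladder_le n (hermiteFun (n - 1) x) (hermiteFun (n + 1) x)
    rw [← mul_hermiteFun] at h
    have h1 : |hermiteFun n x| ≤ (1 / 2) * ((1 + x ^ 2)⁻¹ + (1 + x ^ 2) * hermiteFun n x ^ 2) := by
      rw [← sq_abs (hermiteFun n x)]
      set y := |hermiteFun n x|
      have hp : (0 : ℝ) < 1 + x ^ 2 := by positivity
      have := sq_nonneg (1 - (1 + x ^ 2) * y)
      have h2 : (1 / 2) * ((1 + x ^ 2)⁻¹ + (1 + x ^ 2) * y ^ 2) - y =
          (1 / 2) * (1 - (1 + x ^ 2) * y) ^ 2 / (1 + x ^ 2) := by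
        field_simp
        ring
      have h3 : 0 ≤ (1 / 2) * (1 - (1 + x ^ 2) * y) ^ 2 / (1 + x ^ 2) := by positivity
      linarith
    refine h1.trans ?_
    gcongr
    linarith
  have hi : Integrable (fun x => hermiteFun n x ^ 2 +
      (n * hermiteFun (n - 1) x ^ 2 + (n + 1) * hermiteFun (n + 1) x ^ 2)) :=
    (integrable_hermiteFun_sq n).add (integrable_ladder_sq n)
  refine (integral_mono (integrable_hermiteFun n).abs
    ((integrable_inv_one_add_sq.add hi).const_mul (1 / 2)) hle).trans ?_
  rw [integral_const_mul, integral_add' integrable_inv_one_add_sq hi,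
    integral_add (integrable_hermiteFun_sq n) (integrable_ladder_sq n),
    integral_hermiteFun_sq, integral_ladder_sq, integral_univ_inv_one_add_sq]
  linarith [Real.pi_lt_four, (Nat.cast_nonneg n : (0 : ℝ) ≤ n)]

lemma integrable_hermiteFun_mul_cexp (n : ℕ) (t : ℝ) :
    Integrable (fun x : ℝ =>
      Complex.exp (Complex.I * ((t * x : ℝ) : ℂ)) * (hermiteFun n x : ℂ)) := by
  refine (integrable_hermiteFun n).ofReal.bdd_mul (c := 1) ?_
    (Filter.Eventually.of_forall fun x => ?_)
  · exact Continuous.aestronglyMeasurable (by fun_prop)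
  · rw [mul_comm, Complex.norm_exp_ofReal_mul_I]

lemma integral_cexp_mul_hermiteFun_ladder (n : ℕ) (t : ℝ) :
    (Real.sqrt (n + 1) : ℂ) *
        ∫ x : ℝ, Complex.exp (Complex.I * ((t * x : ℝ) : ℂ)) * (hermiteFun (n + 1) x : ℂ) =
      Complex.I * Real.sqrt 2 * t *
        (∫ x : ℝ, Complex.exp (Complex.I * ((t * x : ℝ) : ℂ)) * (hermiteFun n x : ℂ)) +
      Real.sqrt n *
        ∫ x : ℝ, Complex.exp (Complex.I * ((t * x : ℝ) : ℂ)) * (hermiteFun (n - 1) x : ℂ) := by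
  have hi := fun n => integrable_hermiteFun_mul_cexp n t
  have hu : ∀ x : ℝ, HasDerivAt (fun x : ℝ => Complex.exp (Complex.I * ((t * x : ℝ) : ℂ)))
      (Complex.exp (Complex.I * ((t * x : ℝ) : ℂ)) * (Complex.I * t)) x := fun x => by
    have := ((((hasDerivAt_id x).const_mul t).ofReal_comp).const_mul Complex.I).cexp
    simpa using this
  have e1 : ∀ x : ℝ, Complex.exp (Complex.I * ((t * x : ℝ) : ℂ)) *
      (((Real.sqrt n * hermiteFun (n - 1) x - Real.sqrt (n + 1) * hermiteFun (n + 1) x) /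
        Real.sqrt 2 : ℝ) : ℂ) =
      ((Real.sqrt n : ℂ) *
        (Complex.exp (Complex.I * ((t * x : ℝ) : ℂ)) * (hermiteFun (n - 1) x : ℂ))
      - (Real.sqrt (n + 1) : ℂ) *
        (Complex.exp (Complex.I * ((t * x : ℝ) : ℂ)) * (hermiteFun (n + 1) x : ℂ))) /
        (Real.sqrt 2 : ℂ) := fun x => by
    push_cast
    ring
  have e2 : ∀ x : ℝ, Complex.exp (Complex.I * ((t * x : ℝ) : ℂ)) * (Complex.I * t) *
      (hermiteFun n x : ℂ) = (Complex.I * t) *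
        (Complex.exp (Complex.I * ((t * x : ℝ) : ℂ)) * (hermiteFun n x : ℂ)) := fun x => by ring
  have h := integral_mul_deriv_eq_deriv_mul_of_integrable
    (fun x _ => hu x) (fun x _ => (hasDerivAt_hermiteFun n x).ofReal_comp) ?_ ?_ (hi n)
  · simp_rw [e1, e2] at h
    rw [integral_div, integral_sub ((hi _).const_mul _) ((hi _).const_mul _),
      integral_const_mul, integral_const_mul, integral_const_mul] at h
    have h2 : (Real.sqrt 2 : ℂ) ≠ 0 := by
      have : Real.sqrt 2 ≠ 0 := by positivity
      exact_mod_cast this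
    rw [div_eq_iff h2] at h
    linear_combination -h
  · simp only [Pi.mul_def, e1]
    exact (((hi _).const_mul _).sub ((hi _).const_mul _)).div_const _
  · simp only [Pi.mul_def, e2]
    exact (hi _).const_mul _

/-- The Hermite functions are eigenfunctions of the Fourier transform. -/
lemma integral_cexp_mul_hermiteFun (n : ℕ) (t : ℝ) :
    ∫ x : ℝ, Complex.exp (Complex.I * ((t * x : ℝ) : ℂ)) * (hermiteFun n x : ℂ) =
      Real.sqrt (2 * Real.pi) * Complex.I ^ n * hermiteFun n t := by
  have h0 : ∫ x : ℝ, Complex.exp (Complex.I * ((t * x : ℝ) : ℂ)) * (hermiteFun 0 x : ℂ) =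
      Real.sqrt (2 * Real.pi) * hermiteFun 0 t := by
    have e : ∀ x : ℝ, Complex.exp (Complex.I * ((t * x : ℝ) : ℂ)) * (hermiteFun 0 x : ℂ) =
        (Real.pi ^ (-(1 / 4) : ℝ) : ℝ) *
          (Complex.exp (Complex.I * t * x) * Complex.exp (-(1 / 2 : ℂ) * (x : ℂ) ^ 2)) :=
        fun x => by
      rw [hermiteFun_zero]
      push_cast
      rw [mul_left_comm]
      ring_nf
    simp_rw [e]
    rw [integral_const_mul, fourierIntegral_gaussian (by norm_num), hermiteFun_zero,
      Real.sqrt_eq_rpow]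
    rw [Complex.ofReal_mul, Complex.ofReal_cpow (by positivity) (1 / 2)]
    push_cast
    rw [mul_left_comm]
    ring_nf
  -- The second conjunct carries the previous index through the two-step recurrence. Writing
  -- `I^(n-1)` as `-I^(n+1)` and keeping the factor `√n` makes it trivial at `n = 0`.
  have key : ∀ n, (∫ x : ℝ, Complex.exp (Complex.I * ((t * x : ℝ) : ℂ)) * (hermiteFun n x : ℂ) =
      Real.sqrt (2 * Real.pi) * Complex.I ^ n * hermiteFun n t) ∧
      Real.sqrt n * (∫ x : ℝ, Complex.exp (Complex.I * ((t * x : ℝ) : ℂ)) *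
        (hermiteFun (n - 1) x : ℂ)) =
      - (Real.sqrt n * Real.sqrt (2 * Real.pi) * (Complex.I ^ (n + 1)) * hermiteFun (n - 1) t) := by
    intro n
    induction n with
    | zero => simpa using h0
    | succ n ih =>
      constructor
      · have h := integral_cexp_mul_hermiteFun_ladder n t
        rw [ih.1, ih.2] at h
        have h1 : (Real.sqrt (n + 1) : ℂ) ≠ 0 := by
          have : Real.sqrt ((n : ℝ) + 1) ≠ 0 := by positivity
          exact_mod_cast this
        have h3 := congrArg (fun x : ℝ => (x : ℂ)) (sqrt_mul_hermiteFun_succ n t)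
        push_cast at h3
        apply mul_left_cancel₀ h1
        rw [h]
        linear_combination (-(Real.sqrt (2 * Real.pi) : ℂ) * Complex.I ^ (n + 1)) * h3
      · simp only [Nat.add_sub_cancel]
        rw [ih.1, pow_succ, pow_succ, mul_assoc _ Complex.I Complex.I, Complex.I_mul_I]
        ring
  exact (key n).1

end HermiteFun

/-! ### Shifts of multi-indices. -/

section MultiIndex

variable {ι : Type*} [DecidableEq ι]

/-- `α + e_k`. -/
def raise (α : ι → ℕ) (k : ι) : ι → ℕ := Function.update α k (α k + 1)

/-- `α - e_k`, truncated. -/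
def lower (α : ι → ℕ) (k : ι) : ι → ℕ := Function.update α k (α k - 1)

@[simp] lemma raise_apply (α : ι → ℕ) (k : ι) : raise α k k = α k + 1 := by simp [raise]

lemma raise_lower {α : ι → ℕ} {k : ι} (h : α k ≠ 0) : raise (lower α k) k = α := by
  have : α k - 1 + 1 = α k := by omega
  simp [lower, raise, this]

end MultiIndex

/-! ### Hermite functions of several variables. -/

section HermiteFunction

variable {ι : Type*} [Fintype ι]

/-- A common polynomial bound for the supremum and for the `L¹` norm of `h_α`. -/
noncomputable def weight (α : ι → ℕ) : ℝ := ∏ i, (3 * ((α i : ℝ) + 1))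

lemma weight_pos (α : ι → ℕ) : 0 < weight α := Finset.prod_pos fun i _ => by positivity

lemma continuous_hermiteFunction (α : ι → ℕ) : Continuous (hermiteFunction α) :=
  continuous_finsetProd _ fun i _ => (continuous_hermiteFun _).comp (continuous_apply i)

lemma abs_hermiteFunction_le (α : ι → ℕ) (x : ι → ℝ) : |hermiteFunction α x| ≤ weight α := by
  rw [hermiteFunction, Finset.abs_prod]
  exact Finset.prod_le_prod (fun i _ => abs_nonneg _) fun i _ => abs_hermiteFun_le _ _

lemma integrable_hermiteFunction (α : ι → ℕ) : Integrable (hermiteFunction α) :=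
  Integrable.fintype_prod (f := fun i => hermiteFun (α i)) fun i => integrable_hermiteFun (α i)

lemma integral_abs_hermiteFunction_le (α : ι → ℕ) :
    ∫ x, |hermiteFunction α x| ≤ weight α := by
  have : ∀ x : ι → ℝ, |hermiteFunction α x| = ∏ i, |hermiteFun (α i) (x i)| := fun x => by
    rw [hermiteFunction, Finset.abs_prod]
  simp_rw [this]
  rw [integral_fintype_prod_volume_eq_prod (fun i x => |hermiteFun (α i) x|)]
  exact Finset.prod_le_prod (fun i _ => integral_nonneg fun x => abs_nonneg _)
    fun i _ => integral_abs_hermiteFun_le _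

/-- Orthonormality of the Hermite functions. -/
lemma integral_hermiteFunction_mul (α β : ι → ℕ) :
    ∫ x, hermiteFunction α x * hermiteFunction β x = if α = β then 1 else 0 := by
  simp_rw [hermiteFunction, ← Finset.prod_mul_distrib]
  rw [integral_fintype_prod_volume_eq_prod (fun i x => hermiteFun (α i) x * hermiteFun (β i) x)]
  simp_rw [integral_hermiteFun_mul]
  split_ifs with h
  · simp [h]
  · obtain ⟨i, hi⟩ := Function.ne_iff.1 h
    exact Finset.prod_eq_zero (Finset.mem_univ i) (if_neg hi)

lemma integral_cexp_mul_hermiteFunction (α : ι → ℕ) (t : ι → ℝ) :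
    ∫ x : ι → ℝ, Complex.exp (Complex.I * ((t ⬝ᵥ x : ℝ) : ℂ)) * (hermiteFunction α x : ℂ) =
      (Real.sqrt (2 * Real.pi) : ℂ) ^ Fintype.card ι * Complex.I ^ (∑ i, α i) *
        hermiteFunction α t := by
  have : ∀ x : ι → ℝ, Complex.exp (Complex.I * ((t ⬝ᵥ x : ℝ) : ℂ)) * (hermiteFunction α x : ℂ) =
      ∏ i, (Complex.exp (Complex.I * ((t i * x i : ℝ) : ℂ)) * (hermiteFun (α i) (x i) : ℂ)) :=
    fun x => by
      rw [Finset.prod_mul_distrib, ← Complex.exp_sum, dotProduct, hermiteFunction]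
      push_cast
      rw [Finset.mul_sum]
  simp_rw [this]
  rw [integral_fintype_prod_volume_eq_prod
    (fun i x => Complex.exp (Complex.I * ((t i * x : ℝ) : ℂ)) * (hermiteFun (α i) x : ℂ))]
  simp_rw [integral_cexp_mul_hermiteFun, Finset.prod_mul_distrib, Finset.prod_pow_eq_pow_sum,
    hermiteFunction]
  simp

variable [DecidableEq ι]

lemma sum_raise (α : ι → ℕ) (k : ι) : ∑ i, raise α k i = ∑ i, α i + 1 := by
  have h1 := Finset.sum_update_of_mem (Finset.mem_univ k) α (α k + 1)
  have h2 := Finset.add_sum_erase Finset.univ α (Finset.mem_univ k)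
  rw [Finset.sdiff_singleton_eq_erase] at h1
  rw [raise, h1, ← h2]
  omega

lemma sum_lower_le (α : ι → ℕ) (k : ι) : ∑ i, lower α k i ≤ ∑ i, α i := by
  refine Finset.sum_le_sum fun i _ => ?_
  by_cases h : i = k
  · subst h; simp [lower]
  · simp [lower, h]

lemma hermiteFunction_update (α : ι → ℕ) (k : ι) (m : ℕ) (x : ι → ℝ) :
    hermiteFunction (Function.update α k m) x =
      (∏ i ∈ Finset.univ.erase k, hermiteFun (α i) (x i)) * hermiteFun m (x k) := by
  rw [hermiteFunction, ← Finset.prod_erase_mul _ _ (Finset.mem_univ k)]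
  congr 1
  · refine Finset.prod_congr rfl fun i hi => ?_
    rw [Function.update_of_ne (Finset.ne_of_mem_erase hi)]
  · simp

lemma hermiteFunction_eq_erase (α : ι → ℕ) (k : ι) (x : ι → ℝ) :
    hermiteFunction α x =
      (∏ i ∈ Finset.univ.erase k, hermiteFun (α i) (x i)) * hermiteFun (α k) (x k) := by
  simpa using hermiteFunction_update α k (α k) x

lemma coord_mul_hermiteFunction (α : ι → ℕ) (k : ι) (x : ι → ℝ) :
    x k * hermiteFunction α x =
      (Real.sqrt (α k) * hermiteFunction (lower α k) x +
        Real.sqrt (α k + 1) * hermiteFunction (raise α k) x) / Real.sqrt 2 := by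
  rw [hermiteFunction_eq_erase α k, lower, raise, hermiteFunction_update, hermiteFunction_update,
    mul_left_comm, mul_hermiteFun]
  ring

/-- The partial derivative `∂_k h_α`. -/
noncomputable def partialHermite (α : ι → ℕ) (k : ι) (x : ι → ℝ) : ℝ :=
  (Real.sqrt (α k) * hermiteFunction (lower α k) x -
    Real.sqrt (α k + 1) * hermiteFunction (raise α k) x) / Real.sqrt 2

lemma hasFDerivAt_hermiteFunction (α : ι → ℕ) (x : ι → ℝ) :
    HasFDerivAt (hermiteFunction α)
      (∑ k, partialHermite α k x • (ContinuousLinearMap.proj k : (ι → ℝ) →L[ℝ] ℝ)) x := by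
  have h : ∀ i ∈ Finset.univ, HasFDerivAt (fun x : ι → ℝ => hermiteFun (α i) (x i))
      (((Real.sqrt (α i) * hermiteFun (α i - 1) (x i) -
        Real.sqrt (α i + 1) * hermiteFun (α i + 1) (x i)) / Real.sqrt 2) •
          (ContinuousLinearMap.proj i : (ι → ℝ) →L[ℝ] ℝ)) x := fun i _ =>
    HasDerivAt.comp_hasFDerivAt (h₂ := hermiteFun (α i)) x (hasDerivAt_hermiteFun (α i) (x i))
      (ContinuousLinearMap.proj i : (ι → ℝ) →L[ℝ] ℝ).hasFDerivAt
  refine (HasFDerivAt.finsetProd h).congr_fderiv (Finset.sum_congr rfl fun k _ => ?_)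
  rw [smul_smul]
  congr 1
  rw [partialHermite, lower, raise, hermiteFunction_update, hermiteFunction_update]
  ring

end HermiteFunction

/-! ### Completeness of the Hermite functions. -/

section Completeness

variable {ι : Type*} [Fintype ι]

/-- Trading one factor `ξ ⬝ᵥ x` for neighbouring multi-indices lets inductions on the power run over
all `α` at once. -/
lemma dotProduct_pow_succ_mul_hermiteFunction [DecidableEq ι] (ξ : ι → ℝ) (k : ℕ) (α : ι → ℕ)
    (x : ι → ℝ) :
    (ξ ⬝ᵥ x) ^ (k + 1) * hermiteFunction α x = ∑ j,
      (ξ j * (Real.sqrt (α j) / Real.sqrt 2) *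
          ((ξ ⬝ᵥ x) ^ k * hermiteFunction (lower α j) x) +
        ξ j * (Real.sqrt (α j + 1) / Real.sqrt 2) *
          ((ξ ⬝ᵥ x) ^ k * hermiteFunction (raise α j) x)) := by
  rw [pow_succ, mul_assoc]
  nth_rewrite 2 [dotProduct]
  rw [Finset.sum_mul, Finset.mul_sum]
  refine Finset.sum_congr rfl fun j _ => ?_
  rw [mul_assoc (ξ j), coord_mul_hermiteFunction]
  ring

lemma integrable_dotProduct_pow_mul_hermiteFunction (ξ : ι → ℝ) (k : ℕ) (α : ι → ℕ) :
    Integrable (fun x => (ξ ⬝ᵥ x) ^ k * hermiteFunction α x) := by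
  classical
  induction k generalizing α with
  | zero => simpa using integrable_hermiteFunction α
  | succ k ih =>
    simp_rw [dotProduct_pow_succ_mul_hermiteFunction]
    exact integrable_finsetSum _ fun j _ => ((ih _).const_mul _).add ((ih _).const_mul _)

variable {f : (ι → ℝ) → ℂ} {C : ℝ}

lemma integral_mul_dotProduct_pow_eq_zero (hf : Continuous f) (hb : ∀ x, ‖f x‖ ≤ C)
    (h : ∀ α : ι → ℕ, ∫ x, f x * (hermiteFunction α x : ℂ) = 0) (ξ : ι → ℝ) (k : ℕ) (α : ι → ℕ) :
    ∫ x, f x * (((ξ ⬝ᵥ x) ^ k * hermiteFunction α x : ℝ) : ℂ) = 0 := by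
  classical
  have hi : ∀ k (α : ι → ℕ),
      Integrable (fun x => f x * (((ξ ⬝ᵥ x) ^ k * hermiteFunction α x : ℝ) : ℂ)) := fun k α =>
    (integrable_dotProduct_pow_mul_hermiteFunction ξ k α).ofReal.bdd_mul
      hf.aestronglyMeasurable (Filter.Eventually.of_forall hb)
  induction k generalizing α with
  | zero => simpa using h α
  | succ k ih =>
    have e : ∀ x : ι → ℝ, f x * (((ξ ⬝ᵥ x) ^ (k + 1) * hermiteFunction α x : ℝ) : ℂ) =
        ∑ j, (((ξ j * (Real.sqrt (α j) / Real.sqrt 2) : ℝ) : ℂ) *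
          (f x * (((ξ ⬝ᵥ x) ^ k * hermiteFunction (lower α j) x : ℝ) : ℂ)) +
          ((ξ j * (Real.sqrt (α j + 1) / Real.sqrt 2) : ℝ) : ℂ) *
          (f x * (((ξ ⬝ᵥ x) ^ k * hermiteFunction (raise α j) x : ℝ) : ℂ))) := fun x => by
      rw [dotProduct_pow_succ_mul_hermiteFunction, Complex.ofReal_sum, Finset.mul_sum]
      refine Finset.sum_congr rfl fun j _ => ?_
      push_cast
      ring
    simp_rw [e]
    rw [integral_finsetSum]
    swap
    · exact fun j _ => ((hi _ _).const_mul _).add ((hi _ _).const_mul _)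
    refine Finset.sum_eq_zero fun j _ => ?_
    rw [integral_add ((hi _ _).const_mul _) ((hi _ _).const_mul _), integral_const_mul,
      integral_const_mul, ih, ih]
    simp

lemma hermiteFunction_zero_pos (x : ι → ℝ) : 0 < hermiteFunction (0 : ι → ℕ) x := by
  refine Finset.prod_pos fun i _ => ?_
  rw [Pi.zero_apply, hermiteFun_zero]
  have := Real.pi_pos
  positivity

lemma integrable_exp_abs_mul_hermiteFun_zero (a : ℝ) :
    Integrable (fun x => Real.exp (|a * x|) * hermiteFun 0 x) := by
  refine ((integrable_exp_neg_mul_sq (b := 1 / 4) (by norm_num)).const_mul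
    (Real.pi ^ (-(1 / 4) : ℝ) * Real.exp (a ^ 2))).mono'
    (Continuous.aestronglyMeasurable ?_) (Filter.Eventually.of_forall fun x => ?_)
  · have := continuous_hermiteFun 0
    fun_prop
  · have hpi := Real.pi_pos
    rw [hermiteFun_zero, Real.norm_of_nonneg (by positivity), mul_left_comm, mul_assoc,
      ← Real.exp_add, ← Real.exp_add]
    refine mul_le_mul_of_nonneg_left (Real.exp_le_exp.2 ?_) (by positivity)
    rw [abs_mul]
    nlinarith [sq_nonneg (|a| - |x| / 2), sq_abs a, sq_abs x]

lemma integrable_exp_abs_dotProduct_mul (ξ : ι → ℝ) :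
    Integrable (fun x => Real.exp (|ξ ⬝ᵥ x|) * hermiteFunction (0 : ι → ℕ) x) := by
  refine (Integrable.fintype_prod (f := fun i x => Real.exp (|ξ i * x|) * hermiteFun 0 x)
    fun i => integrable_exp_abs_mul_hermiteFun_zero (ξ i)).mono'
    (Continuous.aestronglyMeasurable ?_) (Filter.Eventually.of_forall fun x => ?_)
  · have := continuous_hermiteFunction (0 : ι → ℕ)
    have h2 : Continuous (fun x : ι → ℝ => ξ ⬝ᵥ x) := by
      unfold dotProduct
      fun_prop
    fun_prop
  · rw [Real.norm_of_nonneg (mul_nonneg (Real.exp_nonneg _) (hermiteFunction_zero_pos x).le),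
      Finset.prod_mul_distrib, ← Real.exp_sum]
    refine mul_le_mul_of_nonneg_right (Real.exp_le_exp.2 ?_) (hermiteFunction_zero_pos x).le
    exact Finset.abs_sum_le_sum_abs _ _

/-- The exponential is expanded in powers of `ξ ⬝ᵥ x`, each of which integrates to zero; the
Gaussian factor `h_0` makes `e^{|ξ ⬝ᵥ x|}` an integrable majorant. -/
lemma integral_cexp_dotProduct_eq_zero (hf : Continuous f) (hb : ∀ x, ‖f x‖ ≤ C)
    (h : ∀ α : ι → ℕ, ∫ x, f x * (hermiteFunction α x : ℂ) = 0) (ξ : ι → ℝ) :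
    ∫ x, Complex.exp (Complex.I * ((ξ ⬝ᵥ x : ℝ) : ℂ)) *
      (f x * (hermiteFunction (0 : ι → ℕ) x : ℂ)) = 0 := by
  have hC : 0 ≤ C := (norm_nonneg _).trans (hb 0)
  have hexp : ∀ y : ℝ, HasSum (fun n : ℕ => y ^ n / (n.factorial : ℝ)) (Real.exp y) := fun y => by
    rw [Real.exp_eq_exp_ℝ]
    exact NormedSpace.expSeries_div_hasSum_exp y
  have hcont : Continuous (fun x : ι → ℝ => ξ ⬝ᵥ x) := by
    unfold dotProduct
    fun_prop
  have hcont0 := continuous_hermiteFunction (0 : ι → ℕ)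
  have key := hasSum_integral_of_dominated_convergence (μ := (volume : Measure (ι → ℝ)))
    (F := fun (k : ℕ) x => Complex.I ^ k / (k.factorial : ℂ) *
      (f x * (((ξ ⬝ᵥ x) ^ k * hermiteFunction (0 : ι → ℕ) x : ℝ) : ℂ)))
    (f := fun x => Complex.exp (Complex.I * ((ξ ⬝ᵥ x : ℝ) : ℂ)) *
      (f x * (hermiteFunction (0 : ι → ℕ) x : ℂ)))
    (fun k x => |ξ ⬝ᵥ x| ^ k / (k.factorial : ℝ) * (C * hermiteFunction (0 : ι → ℕ) x))
    ?_ ?_ ?_ ?_ ?_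
  · have hz : ∀ k : ℕ, ∫ x, Complex.I ^ k / (k.factorial : ℂ) *
      (f x * (((ξ ⬝ᵥ x) ^ k * hermiteFunction (0 : ι → ℕ) x : ℝ) : ℂ)) = 0 := fun k => by
      rw [integral_const_mul, integral_mul_dotProduct_pow_eq_zero hf hb h, mul_zero]
    simp_rw [hz] at key
    exact key.unique hasSum_zero
  · intro k
    exact Continuous.aestronglyMeasurable (by fun_prop)
  · intro k
    refine Filter.Eventually.of_forall fun x => ?_
    have h0 := hermiteFunction_zero_pos x
    rw [norm_mul, norm_div, norm_pow, Complex.norm_I, one_pow, norm_mul, Complex.norm_real,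
      norm_mul, norm_pow, Real.norm_eq_abs, Real.norm_of_nonneg h0.le, Complex.norm_natCast]
    calc _ = |ξ ⬝ᵥ x| ^ k / (k.factorial : ℝ) * (‖f x‖ * hermiteFunction (0 : ι → ℕ) x) := by
          ring
      _ ≤ _ := by
          gcongr
          exact hb x
  · exact Filter.Eventually.of_forall fun x => ((hexp |ξ ⬝ᵥ x|).mul_right _).summable
  · have : ∀ x : ι → ℝ, ∑' k : ℕ, |ξ ⬝ᵥ x| ^ k / (k.factorial : ℝ) *
        (C * hermiteFunction (0 : ι → ℕ) x) =
        C * (Real.exp (|ξ ⬝ᵥ x|) * hermiteFunction (0 : ι → ℕ) x) := fun x => by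
      rw [((hexp |ξ ⬝ᵥ x|).mul_right _).tsum_eq]
      ring
    simp_rw [this]
    exact (integrable_exp_abs_dotProduct_mul ξ).const_mul C
  · refine Filter.Eventually.of_forall fun x => ?_
    have h1 := (NormedSpace.expSeries_div_hasSum_exp (𝔸 := ℂ)
      (Complex.I * ((ξ ⬝ᵥ x : ℝ) : ℂ))).mul_right
        (f x * (hermiteFunction (0 : ι → ℕ) x : ℂ))
    rw [← Complex.exp_eq_exp_ℂ] at h1
    refine h1.congr_fun fun k => ?_
    push_cast
    rw [mul_pow]
    ring

/-- Completeness of the Hermite functions among bounded continuous functions. -/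
lemma eq_zero_of_integral_mul_hermiteFunction_eq_zero (hf : Continuous f) (hb : ∀ x, ‖f x‖ ≤ C)
    (h : ∀ α : ι → ℕ, ∫ x, f x * (hermiteFunction α x : ℂ) = 0) : f = 0 := by
  -- The product `f h_0` is continuous and integrable with vanishing Fourier transform, so Fourier
  -- inversion gives `f h_0 = 0`, and `h_0` has no zeros.
  let F : EuclideanSpace ℝ ι → ℂ := fun v =>
    f (WithLp.ofLp v) * (hermiteFunction (0 : ι → ℕ) (WithLp.ofLp v) : ℂ)
  have hof : Continuous (fun v : EuclideanSpace ℝ ι => (WithLp.ofLp v : ι → ℝ)) :=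
    PiLp.continuous_ofLp 2 _
  have hFc : Continuous F := by
    have h0 := continuous_hermiteFunction (0 : ι → ℕ)
    have h1 := hf.comp hof
    have h2 := h0.comp hof
    exact h1.mul (Complex.continuous_ofReal.comp h2)
  have hFi : Integrable F := by
    rw [← (PiLp.volume_preserving_toLp ι).integrable_comp_emb
      (MeasurableEquiv.toLp 2 _).measurableEmbedding]
    exact (integrable_hermiteFunction (0 : ι → ℕ)).ofReal.bdd_mul
      hf.aestronglyMeasurable (Filter.Eventually.of_forall hb)
  have hFF : FourierTransform.fourier F = 0 := by
    ext w
    rw [Real.fourier_eq', ← (PiLp.volume_preserving_toLp ι).integral_comp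
      (MeasurableEquiv.toLp 2 _).measurableEmbedding]
    rw [Pi.zero_apply,
      -- The factor `-2π` matches the kernel `e^{-2πi⟨v, w⟩}` of the Fourier transform in use.
      ← integral_cexp_dotProduct_eq_zero hf hb h ((-2 * Real.pi) • (WithLp.ofLp w))]
    congr 1
    ext x
    simp only [F, smul_eq_mul]
    congr 2
    simp [PiLp.inner_apply, dotProduct, Finset.mul_sum, Finset.sum_mul]
    refine Finset.sum_congr rfl fun i _ => ?_
    ring
  have hinv := hFc.fourierInv_fourier_eq hFi (by rw [hFF]; exact integrable_zero _ _ _)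
  have hF0 : F = 0 := by
    rw [← hinv, hFF]
    ext v
    rw [Real.fourierInv_eq']
    simp
  ext x
  have hx := congrFun hF0 (WithLp.toLp 2 x)
  simp only [F, Pi.zero_apply, mul_eq_zero, Complex.ofReal_eq_zero] at hx
  exact hx.resolve_right (hermiteFunction_zero_pos x).ne'

end Completeness

/-! ### The matrix of a linear change of variables in the Hermite basis. -/

section Transfer

variable {ι : Type*} [Fintype ι]

/-- The coefficient of `h_β` in the Hermite expansion of `x ↦ h_α (B x)`. -/
noncomputable def transfer (B : Matrix ι ι ℝ) (α β : ι → ℕ) : ℝ :=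
  ∫ x, hermiteFunction α (B.mulVec x) * hermiteFunction β x

lemma continuous_mulVec (B : Matrix ι ι ℝ) : Continuous (fun x : ι → ℝ => B.mulVec x) :=
  continuous_const.matrix_mulVec continuous_id

lemma integrable_comp_mul_hermiteFunction (B : Matrix ι ι ℝ) (α β : ι → ℕ) :
    Integrable (fun x => hermiteFunction α (B.mulVec x) * hermiteFunction β x) :=
  (integrable_hermiteFunction β).bdd_mul
    ((continuous_hermiteFunction α).comp (continuous_mulVec B)).aestronglyMeasurable
    (Filter.Eventually.of_forall fun _ => abs_hermiteFunction_le α _)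

lemma integrable_hermiteFunction_sq (α : ι → ℕ) :
    Integrable (fun x => hermiteFunction α x ^ 2) := by
  classical
  simpa [sq] using integrable_comp_mul_hermiteFunction 1 α α

lemma integral_hermiteFunction_sq (α : ι → ℕ) : ∫ x, hermiteFunction α x ^ 2 = 1 := by
  classical
  simpa [sq] using integral_hermiteFunction_mul α α

lemma integral_comp_mul_linear (B : Matrix ι ι ℝ) (α β γ : ι → ℕ) (p q : ℝ) :
    ∫ x, hermiteFunction α (B.mulVec x) *
      ((p * hermiteFunction β x + q * hermiteFunction γ x) / Real.sqrt 2) =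
      (p * transfer B α β + q * transfer B α γ) / Real.sqrt 2 := by
  have e : ∀ x, hermiteFunction α (B.mulVec x) *
      ((p * hermiteFunction β x + q * hermiteFunction γ x) / Real.sqrt 2) =
      (p * (hermiteFunction α (B.mulVec x) * hermiteFunction β x) +
        q * (hermiteFunction α (B.mulVec x) * hermiteFunction γ x)) / Real.sqrt 2 :=
    fun x => by ring
  simp_rw [e]
  rw [integral_div, integral_add ((integrable_comp_mul_hermiteFunction B α β).const_mul p)
    ((integrable_comp_mul_hermiteFunction B α γ).const_mul q), integral_const_mul,
    integral_const_mul]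
  rfl

lemma integral_linear_comp_mul (B : Matrix ι ι ℝ) (α α' β : ι → ℕ) (p q : ℝ) :
    ∫ x, ((p * hermiteFunction α (B.mulVec x) + q * hermiteFunction α' (B.mulVec x)) /
      Real.sqrt 2) * hermiteFunction β x =
      (p * transfer B α β + q * transfer B α' β) / Real.sqrt 2 := by
  have e : ∀ x, ((p * hermiteFunction α (B.mulVec x) + q * hermiteFunction α' (B.mulVec x)) /
      Real.sqrt 2) * hermiteFunction β x =
      (p * (hermiteFunction α (B.mulVec x) * hermiteFunction β x) +
        q * (hermiteFunction α' (B.mulVec x) * hermiteFunction β x)) / Real.sqrt 2 :=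
    fun x => by ring
  simp_rw [e]
  rw [integral_div, integral_add ((integrable_comp_mul_hermiteFunction B α β).const_mul p)
    ((integrable_comp_mul_hermiteFunction B α' β).const_mul q), integral_const_mul,
    integral_const_mul]
  rfl

lemma integrable_linear_comp_mul (B : Matrix ι ι ℝ) (α α' β : ι → ℕ) (p q : ℝ) :
    Integrable (fun x => ((p * hermiteFunction α (B.mulVec x) +
      q * hermiteFunction α' (B.mulVec x)) / Real.sqrt 2) * hermiteFunction β x) := by
  refine ((((integrable_comp_mul_hermiteFunction B α β).const_mul p).add
    ((integrable_comp_mul_hermiteFunction B α' β).const_mul q)).div_const (Real.sqrt 2)).congr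
    (Filter.Eventually.of_forall fun x => ?_)
  simp only [Pi.add_apply]
  ring

lemma integrable_comp_mul_linear (B : Matrix ι ι ℝ) (α β γ : ι → ℕ) (p q : ℝ) :
    Integrable (fun x => hermiteFunction α (B.mulVec x) *
      ((p * hermiteFunction β x + q * hermiteFunction γ x) / Real.sqrt 2)) := by
  refine ((((integrable_comp_mul_hermiteFunction B α β).const_mul p).add
    ((integrable_comp_mul_hermiteFunction B α γ).const_mul q)).div_const (Real.sqrt 2)).congr
    (Filter.Eventually.of_forall fun x => ?_)
  simp only [Pi.add_apply]
  ring

/-- The size of the coefficients in the ladder relations for `transfer`. -/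
noncomputable def ladderConst (B B' : Matrix ι ι ℝ) : ℝ :=
  ∑ j, ∑ k, (|B k j| + |B' j k|)

lemma ladderConst_nonneg (B B' : Matrix ι ι ℝ) : 0 ≤ ladderConst B B' :=
  Finset.sum_nonneg fun _ _ => Finset.sum_nonneg fun _ _ => by positivity

lemma le_ladderConst (B B' : Matrix ι ι ℝ) (j : ι) :
    ∑ k, |B k j| + ∑ k, |B' j k| ≤ ladderConst B B' := by
  rw [← Finset.sum_add_distrib]
  exact Finset.single_le_sum (f := fun j => ∑ k, (|B k j| + |B' j k|))
    (fun j _ => Finset.sum_nonneg fun _ _ => by positivity) (Finset.mem_univ j)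

variable [DecidableEq ι] {B B' : Matrix ι ι ℝ}

lemma integrable_comp_mulVec (hB : B.det ≠ 0) {g : (ι → ℝ) → ℝ} (hg : Integrable g) :
    Integrable (fun x => g (B.mulVec x)) := by
  have hm := Real.map_matrix_volume_pi_eq_smul_volume_pi hB
  have hgm : Integrable g (Measure.map (Matrix.toLin' B) volume) := by
    rw [hm]
    exact hg.smul_measure ENNReal.ofReal_ne_top
  exact hgm.comp_measurable (continuous_mulVec B).measurable

lemma integral_comp_mulVec (hB : B.det ≠ 0) {g : (ι → ℝ) → ℝ} (hg : Continuous g) :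
    ∫ x, g (B.mulVec x) = |B.det⁻¹| * ∫ x, g x := by
  have hm := Real.map_matrix_volume_pi_eq_smul_volume_pi hB
  have h := integral_map (μ := volume) (φ := fun x => B.mulVec x) (f := g)
    (continuous_mulVec B).aemeasurable hg.aestronglyMeasurable
  rw [← h]
  change ∫ y, g y ∂(Measure.map (Matrix.toLin' B) volume) = _
  rw [hm, integral_smul_measure, ENNReal.toReal_ofReal (abs_nonneg _), smul_eq_mul]

/-- From `|uv| ≤ u² + v²` and the normalization in `L²`; the bound is independent of both
multi-indices. -/
lemma abs_transfer_le (hB : B.det ≠ 0) (α β : ι → ℕ) :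
    |transfer B α β| ≤ |B.det⁻¹| + 1 := by
  have h1 := integrable_comp_mulVec hB (integrable_hermiteFunction_sq α)
  have h2 := integrable_hermiteFunction_sq β
  have hle : ∀ x, |hermiteFunction α (B.mulVec x) * hermiteFunction β x| ≤
      hermiteFunction α (B.mulVec x) ^ 2 + hermiteFunction β x ^ 2 := fun x => by
    set u := hermiteFunction α (B.mulVec x)
    set v := hermiteFunction β x
    rw [abs_le]
    constructor <;> nlinarith [sq_nonneg (u + v), sq_nonneg (u - v), sq_nonneg u, sq_nonneg v]
  calc |transfer B α β| ≤ ∫ x, |hermiteFunction α (B.mulVec x) * hermiteFunction β x| :=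
        abs_integral_le_integral_abs
    _ ≤ ∫ x, (hermiteFunction α (B.mulVec x) ^ 2 + hermiteFunction β x ^ 2) :=
        integral_mono (integrable_comp_mul_hermiteFunction B α β).abs (h1.add h2) hle
    _ = |B.det⁻¹| + 1 := by
        rw [integral_add h1 h2, integral_comp_mulVec hB
          (g := fun x => hermiteFunction α x ^ 2) ((continuous_hermiteFunction α).pow 2),
          integral_hermiteFunction_sq, integral_hermiteFunction_sq, mul_one]

lemma partialHermite_eq (α : ι → ℕ) (k : ι) (x : ι → ℝ) :
    partialHermite α k x = (Real.sqrt (α k) * hermiteFunction (lower α k) x +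
      -Real.sqrt (α k + 1) * hermiteFunction (raise α k) x) / Real.sqrt 2 := by
  rw [partialHermite]
  ring

/-- Multiplication by a coordinate, moved across the change of variables. -/
lemma transfer_coord (hB : B' * B = 1) (α β : ι → ℕ) (j : ι) :
    Real.sqrt (β j) * transfer B α (lower β j) + Real.sqrt (β j + 1) * transfer B α (raise β j) =
      ∑ k, B' j k * (Real.sqrt (α k) * transfer B (lower α k) β +
        Real.sqrt (α k + 1) * transfer B (raise α k) β) := by
  have h2 : (0 : ℝ) < Real.sqrt 2 := by positivity
  have e : ∀ x : ι → ℝ, hermiteFunction α (B.mulVec x) * (x j * hermiteFunction β x) =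
      ∑ k, B' j k * ((B.mulVec x k * hermiteFunction α (B.mulVec x)) * hermiteFunction β x) :=
    fun x => by
      have hx : x j = ∑ k, B' j k * B.mulVec x k := by
        have : B'.mulVec (B.mulVec x) = x := by rw [Matrix.mulVec_mulVec, hB, Matrix.one_mulVec]
        conv_lhs => rw [← this]
        rfl
      nth_rewrite 1 [hx]
      rw [Finset.sum_mul, Finset.mul_sum]
      refine Finset.sum_congr rfl fun k _ => ?_
      ring
  have h := integral_congr_ae (μ := volume) (Filter.Eventually.of_forall e)
  simp_rw [coord_mul_hermiteFunction] at h
  rw [integral_comp_mul_linear, integral_finsetSum] at h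
  · simp_rw [integral_const_mul, integral_linear_comp_mul] at h
    rw [div_eq_iff h2.ne'] at h
    rw [h, Finset.sum_mul]
    refine Finset.sum_congr rfl fun k _ => ?_
    field_simp
  · intro k _
    exact (integrable_linear_comp_mul B _ _ _ _ _).const_mul _

/-- Differentiation in a coordinate, moved across the change of variables. -/
lemma transfer_partial (B : Matrix ι ι ℝ) (α β : ι → ℕ) (j : ι) :
    Real.sqrt (β j) * transfer B α (lower β j) - Real.sqrt (β j + 1) * transfer B α (raise β j) =
      - ∑ k, B k j * (Real.sqrt (α k) * transfer B (lower α k) β -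
        Real.sqrt (α k + 1) * transfer B (raise α k) β) := by
  have h2 : (0 : ℝ) < Real.sqrt 2 := by positivity
  set L : (ι → ℝ) →L[ℝ] (ι → ℝ) := LinearMap.toContinuousLinearMap (Matrix.toLin' B) with hL
  have hLv : ∀ x, L x = B.mulVec x := fun x => rfl
  have hf : ∀ x, HasFDerivAt (fun x => hermiteFunction α (B.mulVec x))
      ((∑ k, partialHermite α k (B.mulVec x) •
        (ContinuousLinearMap.proj k : (ι → ℝ) →L[ℝ] ℝ)).comp L) x := fun x =>
    (hasFDerivAt_hermiteFunction α (B.mulVec x)).comp x L.hasFDerivAt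
  have hfv : ∀ x, ((∑ k, partialHermite α k (B.mulVec x) •
        (ContinuousLinearMap.proj k : (ι → ℝ) →L[ℝ] ℝ)).comp L) (Pi.single j 1) =
      ∑ k, B k j * partialHermite α k (B.mulVec x) := fun x => by
    simp [hLv, mul_comm]
  have hgv : ∀ x, (∑ k, partialHermite β k x •
        (ContinuousLinearMap.proj k : (ι → ℝ) →L[ℝ] ℝ)) (Pi.single j 1) =
      partialHermite β j x := fun x => by
    simp [Pi.single_apply]
  have hsum : ∀ x, (∑ k, B k j * partialHermite α k (B.mulVec x)) * hermiteFunction β x =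
      ∑ k, B k j * (partialHermite α k (B.mulVec x) * hermiteFunction β x) := fun x => by
    rw [Finset.sum_mul]
    exact Finset.sum_congr rfl fun k _ => by ring
  have hInt : ∀ k ∈ Finset.univ, Integrable
      (fun x => B k j * (partialHermite α k (B.mulVec x) * hermiteFunction β x)) := fun k _ => by
    simp_rw [partialHermite_eq]
    exact (integrable_linear_comp_mul B _ _ _ _ _).const_mul _
  have h := integral_bilinear_hasFDerivAt_right_eq_neg_left_of_integrable
    (μ := (volume : Measure (ι → ℝ))) (B := ContinuousLinearMap.mul ℝ ℝ) (v := Pi.single j 1)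
    ?_ ?_ ?_ (fun x _ => hf x) (fun x _ => hasFDerivAt_hermiteFunction β x)
  · simp only [ContinuousLinearMap.mul_apply', hfv, hgv, hsum] at h
    rw [integral_finsetSum _ hInt] at h
    simp_rw [partialHermite_eq, integral_const_mul, integral_linear_comp_mul,
      integral_comp_mul_linear] at h
    simp_rw [← mul_div_assoc] at h
    rw [← Finset.sum_div, ← neg_div, div_left_inj' h2.ne'] at h
    simpa only [neg_mul, ← sub_eq_add_neg] using h
  · simp only [ContinuousLinearMap.mul_apply', hfv, hsum]
    exact integrable_finsetSum _ hInt
  · simp only [ContinuousLinearMap.mul_apply', hgv]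
    simp_rw [partialHermite_eq]
    exact integrable_comp_mul_linear B _ _ _ _ _
  · exact integrable_comp_mul_hermiteFunction B α β

/-- The sign `σ` allows a common estimate for the right-hand sides of `transfer_coord` (`σ = 1`) and
`transfer_partial` (`σ = -1`). -/
lemma abs_sum_ladder_le {β : ι → ℕ} {a : ℕ} {M : ℝ}
    (hM : ∀ α : ι → ℕ, ∑ i, α i ≤ a + 1 → |transfer B α β| ≤ M)
    {α : ι → ℕ} (hα : ∑ i, α i ≤ a) (c : ι → ℝ) {σ : ℝ} (hσ : |σ| ≤ 1) :
    |∑ k, c k * (Real.sqrt (α k) * transfer B (lower α k) β +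
        σ * (Real.sqrt (α k + 1) * transfer B (raise α k) β))| ≤
      (∑ k, |c k|) * (2 * Real.sqrt (a + 1) * M) := by
  rw [Finset.sum_mul]
  refine (Finset.abs_sum_le_sum_abs _ _).trans (Finset.sum_le_sum fun k _ => ?_)
  rw [abs_mul]
  refine mul_le_mul_of_nonneg_left ?_ (abs_nonneg _)
  have hk : α k ≤ a := (Finset.single_le_sum (f := α) (fun _ _ => Nat.zero_le _)
    (Finset.mem_univ k)).trans hα
  have hk' : (α k : ℝ) ≤ a := by exact_mod_cast hk
  have h1 : |transfer B (lower α k) β| ≤ M := hM _ (by have := sum_lower_le α k; omega)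
  have h2 : |transfer B (raise α k) β| ≤ M := hM _ (by rw [sum_raise]; omega)
  have h3 : Real.sqrt (α k) ≤ Real.sqrt (a + 1) := Real.sqrt_le_sqrt (by linarith)
  have h4 : Real.sqrt (α k + 1) ≤ Real.sqrt (a + 1) := Real.sqrt_le_sqrt (by linarith)
  calc _ ≤ |Real.sqrt (α k) * transfer B (lower α k) β| +
        |σ * (Real.sqrt (α k + 1) * transfer B (raise α k) β)| := abs_add_le _ _
    _ = Real.sqrt (α k) * |transfer B (lower α k) β| +
        |σ| * (Real.sqrt (α k + 1) * |transfer B (raise α k) β|) := by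
      rw [abs_mul, abs_mul, abs_mul, abs_of_nonneg (Real.sqrt_nonneg _),
        abs_of_nonneg (Real.sqrt_nonneg _)]
    _ ≤ Real.sqrt (a + 1) * M + 1 * (Real.sqrt (a + 1) * M) := by gcongr
    _ = _ := by ring

/-- The two ladder relations bound the sum and the difference of the same two quantities, hence each
of them. The price is one more unit of `|α|` and a factor `√(a + 1)`. -/
lemma transfer_step (hB : B' * B = 1) {β : ι → ℕ} {a : ℕ} {M : ℝ}
    (hM : ∀ α : ι → ℕ, ∑ i, α i ≤ a + 1 → |transfer B α β| ≤ M)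
    {α : ι → ℕ} (hα : ∑ i, α i ≤ a) (j : ι) :
    Real.sqrt (β j) * |transfer B α (lower β j)| ≤
        ladderConst B B' * (Real.sqrt (a + 1) * M) ∧
      Real.sqrt (β j + 1) * |transfer B α (raise β j)| ≤
        ladderConst B B' * (Real.sqrt (a + 1) * M) := by
  have h1 := abs_sum_ladder_le hM hα (fun k => B' j k) (σ := 1) (by simp)
  have h2 := abs_sum_ladder_le hM hα (fun k => B k j) (σ := -1) (by simp)
  simp only [one_mul, neg_mul, ← sub_eq_add_neg] at h1 h2
  rw [← transfer_coord hB] at h1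
  rw [← abs_neg, ← transfer_partial] at h2
  have hM0 : 0 ≤ M := (abs_nonneg _).trans (hM α (by omega))
  have h3 := mul_le_mul_of_nonneg_right (le_ladderConst B B' j)
    (mul_nonneg (Real.sqrt_nonneg ((a : ℝ) + 1)) hM0)
  set u := Real.sqrt (β j) * transfer B α (lower β j) with hu
  set v := Real.sqrt (β j + 1) * transfer B α (raise β j) with hv
  have hu' : Real.sqrt (β j) * |transfer B α (lower β j)| = |u| := by
    rw [hu, abs_mul, abs_of_nonneg (Real.sqrt_nonneg _)]
  have hv' : Real.sqrt (β j + 1) * |transfer B α (raise β j)| = |v| := by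
    rw [hv, abs_mul, abs_of_nonneg (Real.sqrt_nonneg _)]
  rw [hu', hv']
  rw [abs_le] at h1 h2
  constructor <;> rw [abs_le] <;> constructor <;> linarith

/-- Going down from `β` to `β - e_j` and back up gains `√β_j` each time and returns to the same `β`,
so the estimate can be iterated with `β` fixed. -/
lemma mul_abs_transfer_le (hB : B' * B = 1) {β : ι → ℕ} {a : ℕ} {M : ℝ}
    (hM : ∀ α : ι → ℕ, ∑ i, α i ≤ a + 2 → |transfer B α β| ≤ M)
    {α : ι → ℕ} (hα : ∑ i, α i ≤ a) (j : ι) :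
    β j * |transfer B α β| ≤ ladderConst B B' ^ 2 * (a + 2) * M := by
  have hM0 : 0 ≤ M := (abs_nonneg _).trans (hM α (by omega))
  have hL := ladderConst_nonneg B B'
  by_cases hj : β j = 0
  · rw [hj, Nat.cast_zero, zero_mul]
    positivity
  have hr : raise (lower β j) j = β := raise_lower hj
  have hb : (0 : ℝ) < Real.sqrt (β j) := Real.sqrt_pos.2 (by positivity)
  have hb2 : Real.sqrt (β j) * Real.sqrt (β j) = β j := Real.mul_self_sqrt (by positivity)
  set γ := lower β j with hγ
  have hγj : (γ j : ℝ) + 1 = β j := by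
    have : γ j + 1 = β j := by rw [← raise_apply, hr]
    exact_mod_cast this
  set M' := ladderConst B B' * (Real.sqrt ((a + 1 : ℕ) + 1) * M) / Real.sqrt (β j) with hM'
  have h1 : ∀ α : ι → ℕ, ∑ i, α i ≤ a + 1 → |transfer B α γ| ≤ M' := fun α' hα' => by
    have := (transfer_step hB (a := a + 1) hM hα' j).1
    rw [hM', le_div_iff₀ hb, mul_comm]
    exact this
  have h2 := (transfer_step hB h1 hα j).2
  rw [hr, hγj] at h2
  have h3 : Real.sqrt ((a : ℝ) + 1) ≤ Real.sqrt ((a + 1 : ℕ) + 1) :=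
    Real.sqrt_le_sqrt (by push_cast; linarith)
  have h4 : Real.sqrt ((a + 1 : ℕ) + 1 : ℝ) * Real.sqrt ((a + 1 : ℕ) + 1 : ℝ) = a + 2 := by
    rw [Real.mul_self_sqrt (by positivity)]
    push_cast
    ring
  calc β j * |transfer B α β| = Real.sqrt (β j) * (Real.sqrt (β j) * |transfer B α β|) := by
        rw [← mul_assoc, hb2]
    _ ≤ Real.sqrt (β j) * (ladderConst B B' * (Real.sqrt (a + 1) * M')) := by gcongr
    _ ≤ Real.sqrt (β j) * (ladderConst B B' * (Real.sqrt ((a + 1 : ℕ) + 1) * M')) := by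
        have : 0 ≤ M' := by positivity
        gcongr
    _ = ladderConst B B' ^ 2 * (Real.sqrt ((a + 1 : ℕ) + 1 : ℝ) * Real.sqrt ((a + 1 : ℕ) + 1 : ℝ))
          * M := by
        rw [hM']
        field_simp
    _ = _ := by rw [h4]

lemma sum_mul_abs_transfer_le (hB : B' * B = 1) {β : ι → ℕ} {a : ℕ} {M : ℝ}
    (hM : ∀ α : ι → ℕ, ∑ i, α i ≤ a + 2 → |transfer B α β| ≤ M)
    {α : ι → ℕ} (hα : ∑ i, α i ≤ a) :
    ((∑ i, β i : ℕ) : ℝ) * |transfer B α β| ≤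
      Fintype.card ι * ladderConst B B' ^ 2 * (a + 2) * M := by
  rw [Nat.cast_sum, Finset.sum_mul]
  refine (Finset.sum_le_sum fun j _ => mul_abs_transfer_le hB hM hα j).trans (le_of_eq ?_)
  rw [Finset.sum_const, Finset.card_univ, nsmul_eq_mul]
  ring

/-- Each iteration enlarges the allowed `|α|` by 2, which produces the factors `a + 2i + 2`. -/
lemma pow_mul_abs_transfer_le (hB : B' * B = 1) {D K : ℝ}
    (hD : ∀ α β : ι → ℕ, |transfer B α β| ≤ D)
    (hK : Fintype.card ι * ladderConst B B' ^ 2 ≤ K) (β : ι → ℕ) (N a : ℕ)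
    (α : ι → ℕ) (hα : ∑ i, α i ≤ a) :
    ((∑ i, β i : ℕ) : ℝ) ^ N * |transfer B α β| ≤
      D * K ^ N * ∏ i ∈ Finset.range N, ((a : ℝ) + 2 * i + 2) := by
  have hD0 : 0 ≤ D := (abs_nonneg _).trans (hD α β)
  have hL := ladderConst_nonneg B B'
  have hK0 : 0 ≤ K := le_trans (by positivity) hK
  have hQ : ∀ N a : ℕ, 0 ≤ ∏ i ∈ Finset.range N, ((a : ℝ) + 2 * i + 2) := fun N a =>
    Finset.prod_nonneg fun i _ => by positivity
  induction N generalizing a α with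
  | zero => simpa using hD α β
  | succ N ih =>
    rcases Nat.eq_zero_or_pos (∑ i, β i) with h0 | h0
    · rw [h0, Nat.cast_zero, zero_pow (Nat.succ_ne_zero N), zero_mul]
      have := hQ (N + 1) a
      positivity
    · set b : ℝ := ((∑ i, β i : ℕ) : ℝ) with hb
      have hb0 : 0 < b := Nat.cast_pos.2 h0
      set M := D * K ^ N * (∏ i ∈ Finset.range N, (((a + 2 : ℕ) : ℝ) + 2 * i + 2)) / b ^ N with hM
      have hM0 : 0 ≤ M := by
        have := hQ N (a + 2)
        positivity
      have h1 := sum_mul_abs_transfer_le hB (β := β) (a := a) (M := M)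
        (fun α' hα' => by
          rw [hM, le_div_iff₀ (by positivity), mul_comm]
          exact ih (a + 2) α' hα') hα
      -- The factor `i = 0` comes from the present step; shifting `i` in the others replaces `a` by
      -- `a + 2`.
      rw [Finset.prod_range_succ']
      calc b ^ (N + 1) * |transfer B α β| = b ^ N * (b * |transfer B α β|) := by ring
        _ ≤ b ^ N * (Fintype.card ι * ladderConst B B' ^ 2 * (a + 2) * M) := by gcongr
        _ ≤ b ^ N * (K * (a + 2) * M) := by gcongr
        _ = D * K ^ (N + 1) * ((∏ i ∈ Finset.range N, (((a + 2 : ℕ) : ℝ) + 2 * i + 2)) *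
              ((a : ℝ) + 2)) := by
            rw [hM]
            field_simp
            ring
        _ = _ := by
            congr 2
            · refine Finset.prod_congr rfl fun i _ => ?_
              push_cast
              ring
            · simp

/-- Each factor is at most `2(a + 1 + i)`, and the rising factorial is `N!` times a binomial
coefficient below `2^(a + N)`. Growth no worse than `N!` is what yields exponential decay in `|β|`.
-/
lemma prod_range_le_factorial (a N : ℕ) :
    ∏ i ∈ Finset.range N, ((a : ℝ) + 2 * i + 2) ≤ 2 ^ a * 4 ^ N * N.factorial := by
  have h1 : ∏ i ∈ Finset.range N, ((a : ℝ) + 2 * i + 2) ≤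
      ∏ i ∈ Finset.range N, (2 * ((a + 1 + i : ℕ) : ℝ)) := by
    refine Finset.prod_le_prod (fun i _ => by positivity) fun i _ => ?_
    push_cast
    linarith [(Nat.cast_nonneg a : (0 : ℝ) ≤ a)]
  have h2 : (a + 1).ascFactorial N ≤ N.factorial * 2 ^ (a + N) := by
    rw [Nat.ascFactorial_eq_factorial_mul_choose]
    exact Nat.mul_le_mul_left _ (Nat.choose_le_two_pow _ _)
  refine h1.trans ?_
  rw [Finset.prod_mul_distrib, Finset.prod_const, Finset.card_range, ← Nat.cast_prod,
    ← Nat.ascFactorial_eq_prod_range]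
  calc (2 : ℝ) ^ N * ((a + 1).ascFactorial N : ℝ)
      ≤ 2 ^ N * ((N.factorial * 2 ^ (a + N) : ℕ) : ℝ) := by
        gcongr
    _ = _ := by
        push_cast
        rw [pow_add, show (4 : ℝ) = 2 * 2 by norm_num, mul_pow]
        ring

/-- Off-diagonal exponential decay of the matrix of a linear change of variables. -/
lemma exists_abs_transfer_le (hB : B' * B = 1) :
    ∃ D κ : ℝ, 0 < D ∧ 0 < κ ∧ ∀ α β : ι → ℕ, |transfer B α β| ≤ D ∧
      |transfer B α β| ≤
        D * 2 ^ (∑ i, α i) * Real.exp (-(κ * ((∑ i, β i : ℕ) : ℝ))) := by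
  have hdet : B.det ≠ 0 := by
    intro h
    have := congrArg Matrix.det hB
    rw [Matrix.det_mul, h, mul_zero, Matrix.det_one] at this
    exact zero_ne_one this
  set D := |B.det⁻¹| + 1
  have hD : 0 < D := by positivity
  set K := Fintype.card ι * ladderConst B B' ^ 2 + 1
  have hK : 0 < K := by positivity
  -- With `b/(8K)` the `N`th exponential term gains `(4K)^N/(8K)^N = 2^{-N}`; the geometric sum is
  -- 2, hence `2 * D`.
  refine ⟨2 * D, 1 / (8 * K), by positivity, by positivity, fun α β =>
    ⟨(abs_transfer_le hdet α β).trans (by linarith), ?_⟩⟩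
  set b : ℝ := ((∑ i, β i : ℕ) : ℝ) with hb
  have hterm : ∀ N : ℕ, (b / (8 * K)) ^ N / N.factorial * |transfer B α β| ≤
      D * 2 ^ (∑ i, α i) * (1 / 2) ^ N := fun N => by
    have h1 := pow_mul_abs_transfer_le hB (abs_transfer_le hdet) (K := K) (by linarith) β N
      (∑ i, α i) α le_rfl
    have h2 := prod_range_le_factorial (∑ i, α i) N
    rw [← hb] at h1
    calc (b / (8 * K)) ^ N / N.factorial * |transfer B α β| =
          (b ^ N * |transfer B α β|) / ((8 * K) ^ N * N.factorial) := by
          rw [div_pow]; field_simp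
      _ ≤ (D * K ^ N * (2 ^ (∑ i, α i) * 4 ^ N * N.factorial)) /
            ((8 * K) ^ N * N.factorial) := by
          refine div_le_div_of_nonneg_right (h1.trans ?_) (by positivity)
          exact mul_le_mul_of_nonneg_left h2 (by positivity)
      _ = D * 2 ^ (∑ i, α i) * (1 / 2) ^ N := by
          rw [mul_pow, show (8 : ℝ) = 4 * 2 by norm_num, mul_pow, one_div, inv_pow]
          field_simp
  have hexp : HasSum (fun n : ℕ => (b / (8 * K)) ^ n / (n.factorial : ℝ))
      (Real.exp (b / (8 * K))) := by
    rw [Real.exp_eq_exp_ℝ]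
    exact NormedSpace.expSeries_div_hasSum_exp _
  have h := hasSum_le hterm (hexp.mul_right _) (hasSum_geometric_two.mul_left _)
  rw [show 1 / (8 * K) * b = b / (8 * K) by ring, Real.exp_neg]
  rw [← div_eq_mul_inv, le_div_iff₀ (Real.exp_pos _)]
  linarith

end Transfer

/-! ### Summability from decay of the coefficients. -/

section Summability

lemma exists_pow_le_exp_rpow {r θ : ℝ} (hr : 0 < r) (hθ : 0 < θ) (m : ℕ) :
    ∃ C : ℝ, 0 < C ∧ ∀ n : ℕ, ((n : ℝ) + 1) ^ m ≤ C * Real.exp (r * (n : ℝ) ^ θ) := by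
  obtain ⟨p, hp⟩ := exists_nat_ge ((m : ℝ) / θ)
  rw [div_le_iff₀ hθ] at hp
  refine ⟨1 + 2 ^ m * (p.factorial / r ^ p), by positivity, fun n => ?_⟩
  rcases Nat.eq_zero_or_pos n with h0 | h0
  · subst h0
    rw [Nat.cast_zero, Real.zero_rpow hθ.ne', mul_zero, Real.exp_zero, mul_one, zero_add, one_pow]
    exact le_add_of_nonneg_right (by positivity)
  · have hn : (1 : ℝ) ≤ n := by exact_mod_cast h0
    set u := (n : ℝ) ^ θ with hu
    have hu0 : 0 ≤ u := by positivity
    have h1 : (n : ℝ) ^ m ≤ u ^ p := by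
      rw [hu, ← Real.rpow_natCast, ← Real.rpow_natCast, ← Real.rpow_mul (by positivity)]
      exact Real.rpow_le_rpow_of_exponent_le hn (by linarith)
    have h2 := Real.pow_div_factorial_le_exp (r * u) (by positivity) p
    have h3 : u ^ p ≤ p.factorial / r ^ p * Real.exp (r * u) := by
      rw [div_le_iff₀ (by positivity), mul_pow] at h2
      rw [div_mul_eq_mul_div, le_div_iff₀ (by positivity)]
      linarith
    calc ((n : ℝ) + 1) ^ m ≤ (2 * n) ^ m := by gcongr; linarith
      _ = 2 ^ m * (n : ℝ) ^ m := mul_pow _ _ _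
      _ ≤ 2 ^ m * (p.factorial / r ^ p * Real.exp (r * u)) := by
          gcongr
          exact h1.trans h3
      _ ≤ _ := by
          rw [← mul_assoc]
          gcongr
          linarith

variable {ι : Type*} [Fintype ι]

lemma summable_prod_inv_sq : Summable (fun α : ι → ℕ => ∏ i, (((α i : ℝ) + 1) ^ 2)⁻¹) := by
  classical
  have hs : Summable (fun n : ℕ => (((n : ℝ) + 1) ^ 2)⁻¹) := by
    have := (summable_nat_add_iff 1).2 (Real.summable_nat_pow_inv.2 one_lt_two)
    simpa using this
  refine summable_of_sum_le (c := ∏ _i : ι, ∑' n : ℕ, (((n : ℝ) + 1) ^ 2)⁻¹)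
    (fun α => Finset.prod_nonneg fun i _ => by positivity) fun u => ?_
  calc ∑ α ∈ u, ∏ i, (((α i : ℝ) + 1) ^ 2)⁻¹
      ≤ ∑ α ∈ (Fintype.piFinset (fun i => u.image (fun α : ι → ℕ => α i)) : Finset (ι → ℕ)),
          ∏ i, (((α i : ℝ) + 1) ^ 2)⁻¹ := by
        refine Finset.sum_le_sum_of_subset_of_nonneg (fun α hα => ?_)
          fun α _ _ => Finset.prod_nonneg fun i _ => by positivity
        exact Fintype.mem_piFinset.2 fun i => Finset.mem_image_of_mem _ hα
    _ = ∏ i, ∑ n ∈ u.image (fun α : ι → ℕ => α i), (((n : ℝ) + 1) ^ 2)⁻¹ :=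
        (Finset.prod_univ_sum (fun i => u.image (fun α : ι → ℕ => α i))
          (fun _ (n : ℕ) => (((n : ℝ) + 1) ^ 2)⁻¹)).symm
    _ ≤ _ := Finset.prod_le_prod (fun i _ => Finset.sum_nonneg fun n _ => by positivity)
        fun i _ => hs.sum_le_tsum _ fun n _ => by positivity

/-- The exponential beats every power of `|α| + 1`, so it absorbs the weight together with `∏ (α_i +
1)²`, leaving a convergent product series. -/
lemma summable_exp_mul_weight_pow {r θ : ℝ} (hr : 0 < r) (hθ : 0 < θ) (k : ℕ) :
    Summable (fun α : ι → ℕ =>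
      Real.exp (-(r * ((∑ i, α i : ℕ) : ℝ) ^ θ)) * weight α ^ k) := by
  obtain ⟨C, hC, h⟩ := exists_pow_le_exp_rpow hr hθ ((k + 2) * Fintype.card ι)
  refine Summable.of_nonneg_of_le (fun α => by have := weight_pos α; positivity) (fun α => ?_)
    ((summable_prod_inv_sq (ι := ι)).mul_left (C * (3 ^ Fintype.card ι) ^ k))
  have h1 : ∀ m : ℕ, (∏ i, ((α i : ℝ) + 1)) ^ m ≤
      (((∑ i, α i : ℕ) : ℝ) + 1) ^ (m * Fintype.card ι) := fun m => by
    rw [mul_comm, pow_mul]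
    refine pow_le_pow_left₀ (Finset.prod_nonneg fun i _ => by positivity) ?_ m
    rw [← Finset.card_univ, ← Finset.prod_const]
    refine Finset.prod_le_prod (fun i _ => by positivity) fun i _ => ?_
    have : α i ≤ ∑ i, α i := Finset.single_le_sum (f := α) (fun _ _ => Nat.zero_le _)
      (Finset.mem_univ i)
    have : (α i : ℝ) ≤ ((∑ i, α i : ℕ) : ℝ) := by exact_mod_cast this
    linarith
  have hw : weight α = 3 ^ Fintype.card ι * ∏ i, ((α i : ℝ) + 1) := by
    rw [weight, Finset.prod_mul_distrib, Finset.prod_const, Finset.card_univ]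
  have h2 := (h1 (k + 2)).trans (h (∑ i, α i))
  have hP : 0 < ∏ i, ((α i : ℝ) + 1) := Finset.prod_pos fun i _ => by positivity
  rw [Finset.prod_inv_distrib, Finset.prod_pow, hw, mul_pow, Real.exp_neg]
  set P := ∏ i, ((α i : ℝ) + 1)
  set E := Real.exp (r * ((∑ i, α i : ℕ) : ℝ) ^ θ)
  have hE : 0 < E := Real.exp_pos _
  rw [← div_eq_mul_inv, le_div_iff₀ (by positivity)]
  calc E⁻¹ * ((3 ^ Fintype.card ι) ^ k * P ^ k) * P ^ 2 =
        (3 ^ Fintype.card ι) ^ k * (P ^ (k + 2) * E⁻¹) := by ring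
    _ ≤ (3 ^ Fintype.card ι) ^ k * (C * E * E⁻¹) := by gcongr
    _ = C * (3 ^ Fintype.card ι) ^ k := by
        field_simp

lemma HasDecay.exists_pos {s r : ℝ} {c : (ι → ℕ) → ℂ} (h : HasDecay s r c) :
    ∃ C : ℝ, 0 < C ∧ ∀ α : ι → ℕ,
      ‖c α‖ ≤ C * Real.exp (-(r * ((∑ i, α i : ℕ) : ℝ) ^ (1 / (2 * s)))) := by
  obtain ⟨C, hC⟩ := h
  refine ⟨|C| + 1, by positivity, fun α => (hC α).trans ?_⟩
  gcongr
  linarith [le_abs_self C]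

lemma HasDecay.summable {s r : ℝ} (hs : 0 < s) (hr : 0 < r) {c : (ι → ℕ) → ℂ}
    (h : HasDecay s r c) (k : ℕ) : Summable (fun α => ‖c α‖ * weight α ^ k) := by
  obtain ⟨C, hC, h⟩ := h.exists_pos
  refine Summable.of_nonneg_of_le (fun α => by have := weight_pos α; positivity) (fun α => ?_)
    ((summable_exp_mul_weight_pow (ι := ι) hr (θ := 1 / (2 * s)) (by positivity) k).mul_left C)
  have := weight_pos α
  rw [← mul_assoc]
  gcongr
  exact h α

end Summability

/-! ### Absolutely convergent Hermite series and termwise integration. -/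

section Series

lemma hasSum_mul_integral {I X : Type*} [Countable I] [MeasurableSpace X] {μ : Measure X}
    {c : I → ℂ} {F : I → X → ℂ} {f : X → ℂ} {W : I → ℝ} (hF : ∀ i, Integrable (F i) μ)
    (hW : ∀ i, ∫ x, ‖F i x‖ ∂μ ≤ W i) (hs : Summable fun i => ‖c i‖ * W i)
    (hf : ∀ x, HasSum (fun i => c i * F i x) (f x)) :
    HasSum (fun i => c i * ∫ x, F i x ∂μ) (∫ x, f x ∂μ) := by
  have h := hasSum_integral_of_summable_integral_norm (μ := μ) (F := fun i x => c i * F i x)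
    (fun i => (hF i).const_mul _) ?_
  · simp_rw [integral_const_mul, fun x => (hf x).tsum_eq] at h
    exact h
  · refine Summable.of_nonneg_of_le (fun i => integral_nonneg fun x => norm_nonneg _)
      (fun i => ?_) hs
    simp_rw [norm_mul]
    rw [integral_const_mul]
    exact mul_le_mul_of_nonneg_left (hW i) (norm_nonneg _)

variable {ι : Type*} [Fintype ι] {c : (ι → ℕ) → ℂ} {f : (ι → ℝ) → ℂ}

lemma norm_ofReal_hermiteFunction_le (α : ι → ℕ) (x : ι → ℝ) :
    ‖(hermiteFunction α x : ℂ)‖ ≤ weight α := by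
  rw [Complex.norm_real]
  exact abs_hermiteFunction_le α x

lemma norm_mul_hermiteFunction_le (c : (ι → ℕ) → ℂ) (α : ι → ℕ) (x : ι → ℝ) :
    ‖c α * (hermiteFunction α x : ℂ)‖ ≤ ‖c α‖ * weight α := by
  rw [norm_mul]
  exact mul_le_mul_of_nonneg_left (norm_ofReal_hermiteFunction_le α x) (norm_nonneg _)

lemma isHermiteSeries_tsum (hc : Summable fun α => ‖c α‖ * weight α) :
    IsHermiteSeries c (fun x => ∑' α, c α * (hermiteFunction α x : ℂ)) := fun x =>
  (Summable.of_norm_bounded hc fun α => norm_mul_hermiteFunction_le c α x).hasSum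

lemma IsHermiteSeries.continuous (h : IsHermiteSeries c f)
    (hc : Summable fun α => ‖c α‖ * weight α) : Continuous f := by
  have : f = fun x => ∑' α, c α * (hermiteFunction α x : ℂ) :=
    funext fun x => (h x).tsum_eq.symm
  rw [this]
  refine continuous_tsum (fun α => ?_) hc (norm_mul_hermiteFunction_le c)
  have := continuous_hermiteFunction α
  fun_prop

lemma IsHermiteSeries.norm_le (h : IsHermiteSeries c f)
    (hc : Summable fun α => ‖c α‖ * weight α) (x : ι → ℝ) : ‖f x‖ ≤ ∑' α, ‖c α‖ * weight α := by
  rw [← (h x).tsum_eq]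
  exact tsum_of_norm_bounded hc.hasSum fun α => norm_mul_hermiteFunction_le c α x

lemma IsHermiteSeries.hasSum_integral_comp {Y : Type*} [MeasurableSpace Y] {μ : Measure Y}
    (h : IsHermiteSeries c f) (hc : Summable fun α => ‖c α‖ * weight α)
    {φ : Y → ι → ℝ} (hφ : Measurable φ) {g : Y → ℂ} (hg : Integrable g μ) :
    HasSum (fun α => c α * ∫ y, (hermiteFunction α (φ y) : ℂ) * g y ∂μ)
      (∫ y, f (φ y) * g y ∂μ) := by
  have hi : ∀ α : ι → ℕ, Integrable (fun y => (hermiteFunction α (φ y) : ℂ) * g y) μ := fun α =>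
    hg.bdd_mul (Complex.measurable_ofReal.comp
      ((continuous_hermiteFunction α).measurable.comp hφ)).aestronglyMeasurable
      (Filter.Eventually.of_forall fun y => norm_ofReal_hermiteFunction_le α _)
  refine hasSum_mul_integral (W := fun α => weight α * ∫ y, ‖g y‖ ∂μ) hi (fun α => ?_) ?_
    fun y => ?_
  · rw [← integral_const_mul]
    refine integral_mono (hi α).norm (hg.norm.const_mul _) fun y => ?_
    simp only [norm_mul]
    exact mul_le_mul_of_nonneg_right (norm_ofReal_hermiteFunction_le α _) (norm_nonneg _)
  · simp_rw [← mul_assoc]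
    exact hc.mul_right _
  · simp_rw [← mul_assoc]
    exact (h (φ y)).mul_right _

/-- The coefficients of an absolutely convergent Hermite series are its Fourier coefficients. -/
lemma IsHermiteSeries.integral_mul (h : IsHermiteSeries c f)
    (hc : Summable fun α => ‖c α‖ * weight α) (β : ι → ℕ) :
    ∫ x, f x * (hermiteFunction β x : ℂ) = c β := by
  classical
  have h1 := h.hasSum_integral_comp (φ := id) (μ := volume) hc measurable_id
    (integrable_hermiteFunction β).ofReal
  refine h1.unique ?_
  have h2 : ∀ α : ι → ℕ, ∫ x : ι → ℝ, (hermiteFunction α (id x) : ℂ) * (hermiteFunction β x : ℂ) =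
      if α = β then 1 else 0 := fun α => by
    have := congrArg (fun t : ℝ => (t : ℂ)) (integral_hermiteFunction_mul α β)
    simp only [← integral_complex_ofReal, Complex.ofReal_mul] at this
    simp only [id, this]
    split_ifs <;> simp
  simp_rw [RCLike.ofReal_eq_complex_ofReal] at *
  simp_rw [h2]
  have h3 := hasSum_single (f := fun α => c α * if α = β then 1 else 0) β
    (fun α hα => by simp [hα])
  simpa using h3

lemma IsHermiteSeries.const_mul (h : IsHermiteSeries c f)
    (w : ℂ) : IsHermiteSeries (fun α => w * c α) (fun x => w * f x) := fun x => by
  simp_rw [mul_assoc]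
  exact (h x).mul_left w

/-- The Hermite coefficients of `x ↦ f (B x)`. -/
noncomputable def transferCoeff (B : Matrix ι ι ℝ) (c : (ι → ℕ) → ℂ) (β : ι → ℕ) : ℂ :=
  ∑' α, c α * (transfer B α β : ℂ)

/-- `f ∘ B` and the series with the transferred coefficients are bounded, continuous and have the
same Fourier coefficients, so completeness identifies them pointwise. -/
lemma IsHermiteSeries.comp_mulVec (h : IsHermiteSeries c f)
    (hc : Summable fun α => ‖c α‖ * weight α) (B : Matrix ι ι ℝ)
    (hc' : Summable fun β => ‖transferCoeff B c β‖ * weight β) :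
    IsHermiteSeries (transferCoeff B c) (fun x => f (B.mulVec x)) := by
  set g := fun x => ∑' α, transferCoeff B c α * (hermiteFunction α x : ℂ) with hg
  have hgs : IsHermiteSeries (transferCoeff B c) g := isHermiteSeries_tsum hc'
  have hfc := (h.continuous hc).comp (continuous_mulVec B)
  have hfb : ∀ x, ‖f (B.mulVec x)‖ ≤ ∑' α, ‖c α‖ * weight α := fun x => h.norm_le hc _
  have hgc := hgs.continuous hc'
  have hgb := hgs.norm_le hc'
  have hcoef : ∀ β : ι → ℕ, ∫ x, f (B.mulVec x) * (hermiteFunction β x : ℂ) =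
      transferCoeff B c β := fun β => by
    have h1 := h.hasSum_integral_comp (φ := fun x => B.mulVec x) (μ := volume) hc
      (continuous_mulVec B).measurable (integrable_hermiteFunction β).ofReal
    refine h1.tsum_eq.symm.trans (tsum_congr fun α => ?_)
    rw [transfer, ← integral_complex_ofReal]
    simp
  have hz : (fun x => f (B.mulVec x) - g x) = 0 := by
    refine eq_zero_of_integral_mul_hermiteFunction_eq_zero (hfc.sub hgc)
      (C := (∑' α, ‖c α‖ * weight α) + ∑' β, ‖transferCoeff B c β‖ * weight β)
      (fun x => (norm_sub_le _ _).trans (add_le_add (hfb x) (hgb x))) fun β => ?_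
    simp_rw [sub_mul]
    rw [integral_sub, hcoef, hgs.integral_mul hc', sub_self]
    · exact (integrable_hermiteFunction β).ofReal.bdd_mul hfc.aestronglyMeasurable
        (Filter.Eventually.of_forall hfb)
    · exact (integrable_hermiteFunction β).ofReal.bdd_mul hgc.aestronglyMeasurable
        (Filter.Eventually.of_forall hgb)
  have : (fun x => f (B.mulVec x)) = g := by
    ext x
    exact sub_eq_zero.1 (congrFun hz x)
  rw [this]
  exact hgs

end Series

/-! ### Stability of the spaces under linear changes of variables. -/

section ChangeOfVariables

variable {ι : Type*} [Fintype ι]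

/-- Half of the decay of `c` makes the sum over `α` converge; the other half, combined with the
bounds on `transfer`, gives the decay in `β`. -/
lemma norm_transferCoeff_le {B : Matrix ι ι ℝ} {D κ : ℝ} (hD : 0 < D) (hκ : 0 < κ)
    (hT : ∀ α β : ι → ℕ, |transfer B α β| ≤ D ∧ |transfer B α β| ≤
        D * 2 ^ (∑ i, α i) * Real.exp (-(κ * ((∑ i, β i : ℕ) : ℝ))))
    {s r : ℝ} (hs : 0 < s) (hr : 0 < r) {c : (ι → ℕ) → ℂ} (hc : HasDecay s r c) :
    ∃ C : ℝ, 0 < C ∧ ∀ β : ι → ℕ, ‖transferCoeff B c β‖ ≤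
      C * (Real.exp (-(κ / 2 * ((∑ i, β i : ℕ) : ℝ))) +
        Real.exp (-(r / 2 * (κ / 2) ^ (1 / (2 * s)) *
          ((∑ i, β i : ℕ) : ℝ) ^ (1 / (2 * s))))) := by
  obtain ⟨C, hC, hc⟩ := hc.exists_pos
  set θ := 1 / (2 * s) with hθ
  have hθ0 : 0 < θ := by positivity
  have hsum : Summable (fun α : ι → ℕ => Real.exp (-(r / 2 * ((∑ i, α i : ℕ) : ℝ) ^ θ))) := by
    simpa using summable_exp_mul_weight_pow (ι := ι) (half_pos hr) hθ0 0
  set S := ∑' α : ι → ℕ, Real.exp (-(r / 2 * ((∑ i, α i : ℕ) : ℝ) ^ θ)) with hS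
  have hS0 : 0 ≤ S := tsum_nonneg fun α => (Real.exp_pos _).le
  refine ⟨C * D * (S + 1), by positivity, fun β => ?_⟩
  set b : ℝ := ((∑ i, β i : ℕ) : ℝ) with hb
  have hb0 : 0 ≤ b := Nat.cast_nonneg _
  set E := Real.exp (-(κ / 2 * b)) + Real.exp (-(r / 2 * (κ / 2) ^ θ * b ^ θ)) with hE
  have hE0 : 0 ≤ E := by positivity
  have hterm : ∀ α : ι → ℕ, ‖c α * (transfer B α β : ℂ)‖ ≤
      C * D * E * Real.exp (-(r / 2 * ((∑ i, α i : ℕ) : ℝ) ^ θ)) := fun α => by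
    set a : ℝ := ((∑ i, α i : ℕ) : ℝ) with ha
    have ha0 : 0 ≤ a := Nat.cast_nonneg _
    have hsplit : Real.exp (-(r * a ^ θ)) =
        Real.exp (-(r / 2 * a ^ θ)) * Real.exp (-(r / 2 * a ^ θ)) := by
      rw [← Real.exp_add]
      ring_nf
    have hle1 : Real.exp (-(r / 2 * a ^ θ)) ≤ 1 := Real.exp_le_one_iff.2 (by
      have : 0 ≤ a ^ θ := by positivity
      nlinarith)
    have hmain : Real.exp (-(r / 2 * a ^ θ)) * |transfer B α β| ≤ D * E := by
      -- For small `|α|` the off-diagonal decay outweighs `2^{|α|} ≤ e^{|α|}`; for large `|α|` the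
      -- decay of `c` alone already gives decay in `|β|`.
      rcases le_total a (κ / 2 * b) with hab | hab
      · have h2 : (2 : ℝ) ^ (∑ i, α i) ≤ Real.exp a := by
          rw [ha, ← Real.exp_one_pow]
          gcongr
          linarith [Real.add_one_le_exp 1]
        calc Real.exp (-(r / 2 * a ^ θ)) * |transfer B α β| ≤
              1 * (D * Real.exp a * Real.exp (-(κ * b))) := by
              gcongr
              exact (hT α β).2.trans (by gcongr)
          _ = D * Real.exp (a - κ * b) := by
              rw [one_mul, mul_assoc, ← Real.exp_add, sub_eq_add_neg]
          _ ≤ D * Real.exp (-(κ / 2 * b)) := by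
              gcongr
              linarith
          _ ≤ D * E := by
              gcongr
              rw [hE]
              linarith [Real.exp_pos (-(r / 2 * (κ / 2) ^ θ * b ^ θ))]
      · have h3 : (κ / 2) ^ θ * b ^ θ ≤ a ^ θ := by
          rw [← Real.mul_rpow (by positivity) hb0]
          exact Real.rpow_le_rpow (by positivity) hab hθ0.le
        calc Real.exp (-(r / 2 * a ^ θ)) * |transfer B α β| ≤
              Real.exp (-(r / 2 * (κ / 2) ^ θ * b ^ θ)) * D := by
              refine mul_le_mul (Real.exp_le_exp.2 ?_) (hT α β).1 (abs_nonneg _)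
                (Real.exp_pos _).le
              rw [mul_assoc]
              gcongr
          _ ≤ D * E := by
              rw [mul_comm]
              gcongr
              rw [hE]
              linarith [Real.exp_pos (-(κ / 2 * b))]
    rw [norm_mul, Complex.norm_real, Real.norm_eq_abs]
    calc ‖c α‖ * |transfer B α β| ≤ C * Real.exp (-(r * a ^ θ)) * |transfer B α β| := by
          gcongr
          exact hc α
      _ = C * Real.exp (-(r / 2 * a ^ θ)) *
            (Real.exp (-(r / 2 * a ^ θ)) * |transfer B α β|) := by
          rw [hsplit]
          ring
      _ ≤ C * Real.exp (-(r / 2 * a ^ θ)) * (D * E) := by gcongr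
      _ = _ := by ring
  have h := tsum_of_norm_bounded (hsum.mul_left (C * D * E)).hasSum hterm
  rw [tsum_mul_left, ← hS] at h
  refine h.trans ?_
  calc C * D * E * S = C * D * S * E := by ring
    _ ≤ C * D * (S + 1) * E := by
        gcongr
        linarith

lemma hasDecay_of_exp_add {s : ℝ} {c : (ι → ℕ) → ℂ} {C p q r : ℝ} {M : ℝ} (hC : 0 < C)
    (hc : ∀ β : ι → ℕ, ‖c β‖ ≤ C * (Real.exp (-(p * ((∑ i, β i : ℕ) : ℝ))) +
        Real.exp (-(q * ((∑ i, β i : ℕ) : ℝ) ^ (1 / (2 * s))))))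
    (hp : ∀ n : ℕ, r * (n : ℝ) ^ (1 / (2 * s)) ≤ p * n + M) (hq : r ≤ q) : HasDecay s r c := by
  refine ⟨C * (Real.exp M + 1), fun β => (hc β).trans ?_⟩
  rw [mul_assoc]
  refine mul_le_mul_of_nonneg_left ?_ hC.le
  rw [add_mul, one_mul, ← Real.exp_add]
  refine add_le_add (Real.exp_le_exp.2 ?_) (Real.exp_le_exp.2 ?_)
  · linarith [hp (∑ i, β i)]
  · have : (0 : ℝ) ≤ ((∑ i, β i : ℕ) : ℝ) ^ (1 / (2 * s)) := by positivity
    nlinarith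

lemma rpow_le_self_nat {θ : ℝ} (h0 : 0 < θ) (h1 : θ ≤ 1) (n : ℕ) : (n : ℝ) ^ θ ≤ n := by
  rcases Nat.eq_zero_or_pos n with hn | hn
  · subst hn
    simp [Real.zero_rpow h0.ne']
  · have : (1 : ℝ) ≤ n := by exact_mod_cast hn
    simpa using Real.rpow_le_rpow_of_exponent_le this h1

/-- Strict sublinearity lets an exponential of fixed rate dominate `e^{-r n^θ}`-type decay for every
`r`; this is where the Beurling case uses `s > 1/2`. -/
lemma exists_mul_rpow_le {p r θ : ℝ} (hp : 0 < p) (hr : 0 < r) (h0 : 0 < θ) (h1 : θ < 1) :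
    ∃ M : ℝ, ∀ n : ℕ, r * (n : ℝ) ^ θ ≤ p * n + M := by
  -- The crossover point, where `r b^θ = p b`.
  set b := (r / p) ^ (1 / (1 - θ)) with hb
  have hb0 : 0 < b := by positivity
  refine ⟨r * b ^ θ, fun n => ?_⟩
  rcases le_total (n : ℝ) b with hn | hn
  · have : r * (n : ℝ) ^ θ ≤ r * b ^ θ := by gcongr
    have h2 : 0 ≤ p * n := by positivity
    linarith
  · have hn0 : (0 : ℝ) < n := hb0.trans_le hn
    have h2 : r / p ≤ (n : ℝ) ^ (1 - θ) := by
      have h3 : b ^ (1 - θ) = r / p := by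
        rw [hb, ← Real.rpow_mul (by positivity), one_div, inv_mul_cancel₀ (by linarith),
          Real.rpow_one]
      rw [← h3]
      exact Real.rpow_le_rpow hb0.le hn (by linarith)
    rw [div_le_iff₀ hp] at h2
    have h4 : (n : ℝ) ^ (1 - θ) * (n : ℝ) ^ θ = n := by
      rw [← Real.rpow_add hn0]
      simp
    have h5 : r * (n : ℝ) ^ θ ≤ (n : ℝ) ^ (1 - θ) * p * (n : ℝ) ^ θ := by gcongr
    have h6 : 0 ≤ r * b ^ θ := by positivity
    calc r * (n : ℝ) ^ θ ≤ (n : ℝ) ^ (1 - θ) * p * (n : ℝ) ^ θ := h5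
      _ = p * ((n : ℝ) ^ (1 - θ) * (n : ℝ) ^ θ) := by ring
      _ = p * n := by rw [h4]
      _ ≤ _ := by linarith

variable [DecidableEq ι] {B B' : Matrix ι ι ℝ}

/-- Roumieu spaces of order `s ≥ 1/2` are invariant under linear changes of variables. -/
lemma comp_mulVec_mem_roumieu (hB : B' * B = 1) {s : ℝ} (hs : 1 / 2 ≤ s) {f : (ι → ℝ) → ℂ}
    (hf : f ∈ roumieu ι s) : (fun x => f (B.mulVec x)) ∈ roumieu ι s := by
  obtain ⟨c, ⟨r, hr, hc⟩, hcf⟩ := hf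
  obtain ⟨D, κ, hD, hκ, hT⟩ := exists_abs_transfer_le hB
  have hs0 : 0 < s := by linarith
  obtain ⟨C, hC, hle⟩ := norm_transferCoeff_le hD hκ hT hs0 hr hc
  have hθ0 : 0 < 1 / (2 * s) := by positivity
  have hθ1 : 1 / (2 * s) ≤ 1 := by
    rw [div_le_one (by positivity)]
    linarith
  have hρ : 0 < min (κ / 2) (r / 2 * (κ / 2) ^ (1 / (2 * s))) :=
    lt_min (by positivity) (by positivity)
  have hdec : HasDecay s (min (κ / 2) (r / 2 * (κ / 2) ^ (1 / (2 * s)))) (transferCoeff B c) := by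
    refine hasDecay_of_exp_add (M := 0) hC hle (fun n => ?_) (min_le_right _ _)
    rw [add_zero]
    exact mul_le_mul (min_le_left _ _) (rpow_le_self_nat hθ0 hθ1 n) (by positivity)
      (by positivity)
  refine ⟨_, ⟨_, hρ, hdec⟩, hcf.comp_mulVec ?_ B ?_⟩
  · simpa using hc.summable hs0 hr 1
  · simpa using hdec.summable hs0 hρ 1

/-- Beurling spaces of order `s > 1/2` are invariant under linear changes of variables. -/
lemma comp_mulVec_mem_beurling (hB : B' * B = 1) {s : ℝ} (hs : 1 / 2 < s) {f : (ι → ℝ) → ℂ}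
    (hf : f ∈ beurling ι s) : (fun x => f (B.mulVec x)) ∈ beurling ι s := by
  obtain ⟨c, hc, hcf⟩ := hf
  obtain ⟨D, κ, hD, hκ, hT⟩ := exists_abs_transfer_le hB
  have hs0 : 0 < s := by linarith
  have hθ0 : 0 < 1 / (2 * s) := by positivity
  have hθ1 : 1 / (2 * s) < 1 := by
    rw [div_lt_one (by positivity)]
    linarith
  have hdec : ∀ r : ℝ, 0 < r → HasDecay s r (transferCoeff B c) := fun r hr => by
    have hk : 0 < (κ / 2) ^ (1 / (2 * s)) := by positivity
    obtain ⟨C, hC, hle⟩ := norm_transferCoeff_le hD hκ hT hs0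
      -- Chosen so that the rate delivered after the change of variables is exactly `r`.
      (r := 2 * r / (κ / 2) ^ (1 / (2 * s))) (by positivity) (hc _ (by positivity))
    obtain ⟨M, hM⟩ := exists_mul_rpow_le (half_pos hκ) hr hθ0 hθ1
    refine hasDecay_of_exp_add hC hle hM (le_of_eq ?_)
    field_simp
  refine ⟨_, hdec, hcf.comp_mulVec ?_ B ?_⟩
  · simpa using (hc 1 one_pos).summable hs0 one_pos 1
  · simpa using (hdec 1 one_pos).summable hs0 one_pos 1

end ChangeOfVariables

/-! ### Splitting the variables and the partial Fourier transform on coefficients. -/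

section Split

variable {κ : Type*} [Fintype κ]

lemma hermiteFunction_sum_elim (α : κ ⊕ κ → ℕ) (u v : κ → ℝ) :
    hermiteFunction α (Sum.elim u v) =
      hermiteFunction (α ∘ Sum.inl) u * hermiteFunction (α ∘ Sum.inr) v := by
  simp [hermiteFunction, Fintype.prod_sum_type]

lemma weight_eq_mul (α : κ ⊕ κ → ℕ) :
    weight α = weight (α ∘ Sum.inl) * weight (α ∘ Sum.inr) := by
  simp [weight, Fintype.prod_sum_type]

lemma sum_eq_add (α : κ ⊕ κ → ℕ) :
    ∑ i, α i = ∑ i, (α ∘ Sum.inl) i + ∑ i, (α ∘ Sum.inr) i := by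
  simp [Fintype.sum_sum_type]

/-- Hermite coefficients after a Fourier transform in the second half of the variables. -/
noncomputable def twist (c : (κ ⊕ κ → ℕ) → ℂ) (α : κ ⊕ κ → ℕ) : ℂ :=
  Complex.I ^ (∑ i, (α ∘ Sum.inr) i) * c α

lemma norm_twist (c : (κ ⊕ κ → ℕ) → ℂ) (α : κ ⊕ κ → ℕ) : ‖twist c α‖ = ‖c α‖ := by
  rw [twist, norm_mul, norm_pow, Complex.norm_I, one_pow, one_mul]

/-- Hermite coefficients after an inverse Fourier transform in the second half of the variables. -/
noncomputable def untwist (c : (κ ⊕ κ → ℕ) → ℂ) (α : κ ⊕ κ → ℕ) : ℂ :=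
  (-Complex.I) ^ (∑ i, (α ∘ Sum.inr) i) * c α

lemma norm_untwist (c : (κ ⊕ κ → ℕ) → ℂ) (α : κ ⊕ κ → ℕ) : ‖untwist c α‖ = ‖c α‖ := by
  rw [untwist, norm_mul, norm_pow, norm_neg, Complex.norm_I, one_pow, one_mul]

lemma twist_untwist (c : (κ ⊕ κ → ℕ) → ℂ) : twist (untwist c) = c := by
  ext α
  rw [twist, untwist, ← mul_assoc, ← mul_pow]
  simp

end Split

/-! ### From symbols to kernels. -/

section Kernel

variable {d : ℕ} {c : (Fin d ⊕ Fin d → ℕ) → ℂ} {a b : (Fin d ⊕ Fin d → ℝ) → ℂ}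

/-- Termwise, the Fourier integral of `h_γ` in `ξ` is `I^{|γ|} (2π)^{d/2} h_γ`. The scalar `w`
stands for the value `f y`. -/
lemma integral_symbol_mul_cexp (hc : Summable fun α => ‖c α‖ * weight α)
    (ha : IsHermiteSeries c a) (hb : IsHermiteSeries (twist c) b) (u t : Fin d → ℝ) (w : ℂ) :
    ∫ ξ : Fin d → ℝ, a (Sum.elim u ξ) * w * Complex.exp (Complex.I * ((t ⬝ᵥ ξ : ℝ) : ℂ)) =
      (Real.sqrt (2 * Real.pi) : ℂ) ^ d * (b (Sum.elim u t) * w) := by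
  have hexp : ∀ (β : Fin d → ℕ), Integrable (fun ξ : Fin d → ℝ =>
      Complex.exp (Complex.I * ((t ⬝ᵥ ξ : ℝ) : ℂ)) * (hermiteFunction β ξ : ℂ)) := fun β => by
    refine (integrable_hermiteFunction β).ofReal.bdd_mul (c := 1)
      (Continuous.aestronglyMeasurable ?_) (Filter.Eventually.of_forall fun ξ => ?_)
    · unfold dotProduct
      fun_prop
    · rw [mul_comm, Complex.norm_exp_ofReal_mul_I]
  have h := hasSum_mul_integral (μ := (volume : Measure (Fin d → ℝ))) (c := c)
    (F := fun α ξ => ((hermiteFunction (α ∘ Sum.inl) u : ℂ) * w) *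
      (Complex.exp (Complex.I * ((t ⬝ᵥ ξ : ℝ) : ℂ)) * (hermiteFunction (α ∘ Sum.inr) ξ : ℂ)))
    (f := fun ξ => a (Sum.elim u ξ) * w * Complex.exp (Complex.I * ((t ⬝ᵥ ξ : ℝ) : ℂ)))
    (W := fun α => weight α * ‖w‖) (fun α => (hexp _).const_mul _) (fun α => ?_) ?_ fun ξ => ?_
  · refine h.unique ?_
    have h2 := ((hb (Sum.elim u t)).mul_right w).mul_left ((Real.sqrt (2 * Real.pi) : ℂ) ^ d)
    refine h2.congr_fun fun α => ?_
    rw [integral_const_mul, integral_cexp_mul_hermiteFunction, Fintype.card_fin, twist,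
      hermiteFunction_sum_elim]
    push_cast
    ring
  · have : ∀ ξ : Fin d → ℝ, ‖((hermiteFunction (α ∘ Sum.inl) u : ℂ) * w) *
      (Complex.exp (Complex.I * ((t ⬝ᵥ ξ : ℝ) : ℂ)) * (hermiteFunction (α ∘ Sum.inr) ξ : ℂ))‖ =
        |hermiteFunction (α ∘ Sum.inl) u| * ‖w‖ * |hermiteFunction (α ∘ Sum.inr) ξ| := fun ξ => by
      rw [norm_mul, norm_mul, norm_mul, mul_comm Complex.I, Complex.norm_exp_ofReal_mul_I,
        Complex.norm_real, Complex.norm_real, one_mul, Real.norm_eq_abs, Real.norm_eq_abs]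
    simp_rw [this]
    rw [integral_const_mul, weight_eq_mul, mul_right_comm (weight _)]
    have h1 := abs_hermiteFunction_le (α ∘ Sum.inl) u
    have h2 := integral_abs_hermiteFunction_le (α ∘ Sum.inr)
    have h3 := weight_pos (α ∘ Sum.inl)
    exact mul_le_mul (by gcongr) h2 (integral_nonneg fun _ => abs_nonneg _) (by positivity)
  · simp_rw [← mul_assoc]
    exact hc.mul_right _
  · have h2 := ((ha (Sum.elim u ξ)).mul_right w).mul_right
      (Complex.exp (Complex.I * ((t ⬝ᵥ ξ : ℝ) : ℂ)))
    refine h2.congr_fun fun α => ?_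
    rw [hermiteFunction_sum_elim]
    push_cast
    ring

/-- The linear map `(x, y) ↦ (x - A (x - y), x - y)`. -/
def kernelMatrix (A : Matrix (Fin d) (Fin d) ℝ) : Matrix (Fin d ⊕ Fin d) (Fin d ⊕ Fin d) ℝ :=
  Matrix.fromBlocks (1 - A) A 1 (-1)

/-- The inverse `(u, t) ↦ (u + A t, u + A t - t)` of `kernelMatrix A`. -/
def kernelMatrixInv (A : Matrix (Fin d) (Fin d) ℝ) : Matrix (Fin d ⊕ Fin d) (Fin d ⊕ Fin d) ℝ :=
  Matrix.fromBlocks 1 A 1 (A - 1)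

lemma kernelMatrixInv_mul (A : Matrix (Fin d) (Fin d) ℝ) :
    kernelMatrixInv A * kernelMatrix A = 1 := by
  rw [kernelMatrixInv, kernelMatrix, Matrix.fromBlocks_multiply, ← Matrix.fromBlocks_one]
  congr 1 <;> simp

lemma kernelMatrix_mulVec (A : Matrix (Fin d) (Fin d) ℝ) (x y : Fin d → ℝ) :
    (kernelMatrix A).mulVec (Sum.elim x y) = Sum.elim (x - A.mulVec (x - y)) (x - y) := by
  rw [kernelMatrix, Matrix.fromBlocks_mulVec]
  congr 1
  · simp only [Sum.elim_comp_inl, Sum.elim_comp_inr, Matrix.sub_mulVec, Matrix.one_mulVec,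
      Matrix.mulVec_sub]
    abel
  · simp [Matrix.neg_mulVec, sub_eq_add_neg]

/-- The normalizing constant between symbols and kernels. -/
noncomputable def kernelConst (d : ℕ) : ℂ :=
  ((2 * Real.pi : ℝ) : ℂ)⁻¹ ^ d * (Real.sqrt (2 * Real.pi) : ℂ) ^ d

lemma kernelConst_ne_zero (d : ℕ) : kernelConst d ≠ 0 := by
  have h1 : 2 * Real.pi ≠ 0 := by positivity
  have h2 : Real.sqrt (2 * Real.pi) ≠ 0 := by positivity
  refine mul_ne_zero (pow_ne_zero _ (inv_ne_zero ?_)) (pow_ne_zero _ ?_)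
  · exact_mod_cast h1
  · exact_mod_cast h2

/-- Only the inner integral is evaluated, for each fixed `y`, so `f` may be arbitrary; in particular
it may be the output of another operator. -/
lemma Op_eq_integral (hc : Summable fun α => ‖c α‖ * weight α)
    (ha : IsHermiteSeries c a) (hb : IsHermiteSeries (twist c) b) (A : Matrix (Fin d) (Fin d) ℝ)
    (f : (Fin d → ℝ) → ℂ) (x : Fin d → ℝ) :
    Op A a f x =
      ∫ y, (kernelConst d * b ((kernelMatrix A).mulVec (Sum.elim x y))) * f y := by
  rw [Op]
  simp_rw [integral_symbol_mul_cexp hc ha hb]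
  rw [integral_const_mul, ← mul_assoc, ← integral_const_mul]
  simp_rw [kernelMatrix_mulVec, kernelConst, mul_assoc]

end Kernel

/-! ### Composition of kernels as multiplication of coefficient matrices. -/

section Composition

variable {κ : Type*} [Fintype κ]

lemma IsHermiteSeries.hasSum_integral_kernel {c : (κ ⊕ κ → ℕ) → ℂ} {K : (κ ⊕ κ → ℝ) → ℂ}
    (hK : IsHermiteSeries c K) (hc : Summable fun α => ‖c α‖ * weight α)
    {f : (κ → ℝ) → ℂ} (hf : Integrable f) (x : κ → ℝ) :
    HasSum (fun α => c α * ((hermiteFunction (α ∘ Sum.inl) x : ℂ) *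
      ∫ y, (hermiteFunction (α ∘ Sum.inr) y : ℂ) * f y)) (∫ y, K (Sum.elim x y) * f y) := by
  have hφ : Measurable (fun y : κ → ℝ => Sum.elim x y) := by
    refine measurable_pi_iff.2 fun i => ?_
    cases i with
    | inl i => exact measurable_const
    | inr i => exact measurable_pi_apply i
  refine (hK.hasSum_integral_comp hc hφ hf).congr_fun fun α => ?_
  simp_rw [hermiteFunction_sum_elim, Complex.ofReal_mul, mul_assoc]
  rw [integral_const_mul]

variable {c₁ c₂ c : (κ ⊕ κ → ℕ) → ℂ} {K₁ K₂ K : (κ ⊕ κ → ℝ) → ℂ} {e : (κ → ℕ) → ℂ}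

/-- Composition of integral operators, the second one diagonal in the Hermite basis. -/
lemma integral_kernel_comp (hK₁ : IsHermiteSeries c₁ K₁) (hK₂ : IsHermiteSeries c₂ K₂)
    (hK : IsHermiteSeries c K) (hc₁ : Summable fun α => ‖c₁ α‖ * weight α)
    (hc₂ : Summable fun α => ‖c₂ α‖ * weight α) (hc : Summable fun α => ‖c α‖ * weight α)
    (hdiag : ∀ γ, c₂ (Sum.elim γ γ) = e γ) (hoff : ∀ α, α ∘ Sum.inl ≠ α ∘ Sum.inr → c₂ α = 0)
    (hmul : ∀ α, c₁ α * e (α ∘ Sum.inr) = c α) {f : (κ → ℝ) → ℂ} (hf : Integrable f)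
    (x : κ → ℝ) :
    ∫ y, K (Sum.elim x y) * f y =
      ∫ z, K₁ (Sum.elim x z) * ∫ y, K₂ (Sum.elim z y) * f y := by
  set g : (κ → ℝ) → ℂ := fun z => ∫ y, K₂ (Sum.elim z y) * f y with hg
  set F : (κ → ℕ) → ℂ := fun γ => ∫ y, (hermiteFunction γ y : ℂ) * f y with hF
  have hinj : Function.Injective (fun γ : κ → ℕ => (Sum.elim γ γ : κ ⊕ κ → ℕ)) := fun γ γ' h => by
    ext i
    exact congrFun h (Sum.inl i)
  have hFle : ∀ γ, ‖F γ‖ ≤ weight γ * ∫ y, ‖f y‖ := fun γ => by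
    rw [← integral_const_mul]
    refine norm_integral_le_of_norm_le (hf.norm.const_mul _)
      (Filter.Eventually.of_forall fun y => ?_)
    rw [norm_mul]
    exact mul_le_mul_of_nonneg_right (norm_ofReal_hermiteFunction_le γ y) (norm_nonneg _)
  -- The diagonal operator multiplies the Hermite coefficients `F γ` of `f` by `e γ`; the double
  -- series collapses to the diagonal.
  have hgs : IsHermiteSeries (fun γ => e γ * F γ) g := fun z => by
    have h := hK₂.hasSum_integral_kernel hc₂ hf z
    rw [← hinj.hasSum_iff] at h
    · refine h.congr_fun fun γ => ?_
      simp only [Function.comp_apply, hdiag, Sum.elim_comp_inl, Sum.elim_comp_inr, hF]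
      ring
    · intro α hα
      rw [hoff α, zero_mul]
      intro h'
      refine hα ⟨α ∘ Sum.inl, ?_⟩
      ext i
      cases i with
      | inl i => rfl
      | inr i => exact congrFun h' i
  have hes : Summable fun γ => ‖e γ * F γ‖ * weight γ := by
    refine Summable.of_nonneg_of_le (fun γ => mul_nonneg (norm_nonneg _) (weight_pos γ).le)
      (fun γ => ?_) ((hc₂.comp_injective hinj).mul_right (∫ y, ‖f y‖))
    simp only [Function.comp_apply, hdiag, weight_eq_mul, Sum.elim_comp_inl, Sum.elim_comp_inr]
    have := weight_pos γ
    calc ‖e γ * F γ‖ * weight γ ≤ ‖e γ‖ * (weight γ * ∫ y, ‖f y‖) * weight γ := by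
          rw [norm_mul]
          gcongr
          exact hFle γ
      _ = _ := by ring
  set G := ∑' γ, ‖e γ * F γ‖ * weight γ with hG
  have hgle : ∀ z, ‖g z‖ ≤ G := hgs.norm_le hes
  have hgc : Continuous g := hgs.continuous hes
  have hG0 : 0 ≤ G := (norm_nonneg _).trans (hgle 0)
  have hi : ∀ γ : κ → ℕ, Integrable (fun z => g z * (hermiteFunction γ z : ℂ)) := fun γ =>
    (integrable_hermiteFunction γ).ofReal.bdd_mul hgc.aestronglyMeasurable
      (Filter.Eventually.of_forall hgle)
  have h := hasSum_mul_integral (μ := (volume : Measure (κ → ℝ))) (c := c₁)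
    (F := fun α z => (hermiteFunction (α ∘ Sum.inl) x : ℂ) *
      (g z * (hermiteFunction (α ∘ Sum.inr) z : ℂ)))
    (f := fun z => K₁ (Sum.elim x z) * g z)
    (W := fun α => weight α * G) (fun α => (hi _).const_mul _) (fun α => ?_) ?_ fun z => ?_
  · refine (hK.hasSum_integral_kernel hc hf x).unique (h.congr_fun fun α => ?_)
    rw [integral_const_mul, hgs.integral_mul hes, ← hmul α]
    ring
  · simp_rw [norm_mul]
    rw [integral_const_mul, weight_eq_mul, mul_assoc]
    refine mul_le_mul (norm_ofReal_hermiteFunction_le _ _) ?_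
      (integral_nonneg fun z => by positivity) (weight_pos _).le
    calc ∫ z, ‖g z‖ * ‖(hermiteFunction (α ∘ Sum.inr) z : ℂ)‖ ≤
          ∫ z, G * |hermiteFunction (α ∘ Sum.inr) z| := by
          refine integral_mono ?_ ((integrable_hermiteFunction _).abs.const_mul _) fun z => ?_
          · simpa only [norm_mul] using (hi (α ∘ Sum.inr)).norm
          · simp only [Complex.norm_real, Real.norm_eq_abs]
            exact mul_le_mul_of_nonneg_right (hgle z) (abs_nonneg _)
      _ ≤ weight (α ∘ Sum.inr) * G := by
          rw [integral_const_mul, mul_comm]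
          exact mul_le_mul_of_nonneg_right (integral_abs_hermiteFunction_le _) hG0
  · simp_rw [← mul_assoc]
    exact hc₁.mul_right _
  · refine ((hK₁ (Sum.elim x z)).mul_right (g z)).congr_fun fun α => ?_
    rw [hermiteFunction_sum_elim]
    push_cast
    ring

end Composition

/-! ### Factorization of the coefficient matrix. -/

section Factorization

variable {κ : Type*} [Fintype κ]

/-- `sup_{|α| ≥ m} |c_α|^{1/2}`. -/
noncomputable def tailRoot (c : (κ ⊕ κ → ℕ) → ℂ) (m : ℕ) : ℝ :=
  ⨆ α : {α : κ ⊕ κ → ℕ // m ≤ ∑ i, α i}, Real.sqrt ‖c α‖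

lemma tailRoot_nonneg (c : (κ ⊕ κ → ℕ) → ℂ) (m : ℕ) : 0 ≤ tailRoot c m :=
  Real.iSup_nonneg fun _ => Real.sqrt_nonneg _

lemma HasDecay.exists_sqrt_le {s r : ℝ} {c : (κ ⊕ κ → ℕ) → ℂ} (h : HasDecay s r c) :
    ∃ C : ℝ, 0 < C ∧ ∀ α, Real.sqrt ‖c α‖ ≤
      C * Real.exp (-(r / 2 * ((∑ i, α i : ℕ) : ℝ) ^ (1 / (2 * s)))) := by
  obtain ⟨C, hC, h⟩ := h.exists_pos
  refine ⟨Real.sqrt C, Real.sqrt_pos.2 hC, fun α => ?_⟩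
  rw [Real.sqrt_le_left (by positivity), mul_pow, Real.sq_sqrt hC.le, ← Real.exp_nat_mul]
  refine (h α).trans (le_of_eq ?_)
  congr 2
  push_cast
  ring

variable {s r : ℝ} {c : (κ ⊕ κ → ℕ) → ℂ}

lemma sqrt_le_tailRoot (hr : 0 < r) (h : HasDecay s r c) {m : ℕ} {α : κ ⊕ κ → ℕ}
    (hα : m ≤ ∑ i, α i) : Real.sqrt ‖c α‖ ≤ tailRoot c m := by
  obtain ⟨C, hC, h⟩ := h.exists_sqrt_le
  refine le_ciSup (f := fun α : {α : κ ⊕ κ → ℕ // m ≤ ∑ i, α i} => Real.sqrt ‖c α‖)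
    ⟨C, ?_⟩ ⟨α, hα⟩
  rintro _ ⟨β, rfl⟩
  refine (h β).trans (mul_le_of_le_one_right hC.le (Real.exp_le_one_iff.2 ?_))
  rw [neg_nonpos]
  positivity

lemma tailRoot_le (hs : 0 < s) (hr : 0 < r) (h : HasDecay s r c) :
    ∃ C : ℝ, 0 < C ∧ ∀ m : ℕ, tailRoot c m ≤
      C * Real.exp (-(r / 2 * (m : ℝ) ^ (1 / (2 * s)))) := by
  obtain ⟨C, hC, h⟩ := h.exists_sqrt_le
  -- Nonnegativity of the bound covers an empty index set (`κ` empty, `m > 0`), where the supremum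
  -- is 0.
  refine ⟨C, hC, fun m => Real.iSup_le (fun α => (h α).trans ?_) (by positivity)⟩
  have : (m : ℝ) ≤ ((∑ i, α.1 i : ℕ) : ℝ) := by exact_mod_cast α.2
  gcongr

/-- The left factor of the matrix `c`. -/
noncomputable def leftFactor (c : (κ ⊕ κ → ℕ) → ℂ) (α : κ ⊕ κ → ℕ) : ℂ :=
  c α / (tailRoot c (∑ i, (α ∘ Sum.inr) i) : ℂ)

open Classical in
/-- The right, diagonal factor of the matrix `c`. -/
noncomputable def rightFactor (c : (κ ⊕ κ → ℕ) → ℂ) (α : κ ⊕ κ → ℕ) : ℂ :=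
  if α ∘ Sum.inl = α ∘ Sum.inr then (tailRoot c (∑ i, (α ∘ Sum.inr) i) : ℂ) else 0

/-- Because `|α|` is at least the length of its second half, `α` competes in the supremum in the
denominator, which is therefore at least `√‖c α‖`. -/
lemma norm_leftFactor_le (hr : 0 < r) (h : HasDecay s r c) (α : κ ⊕ κ → ℕ) :
    ‖leftFactor c α‖ ≤ Real.sqrt ‖c α‖ := by
  have h1 : Real.sqrt ‖c α‖ ≤ tailRoot c (∑ i, (α ∘ Sum.inr) i) :=
    sqrt_le_tailRoot hr h (by rw [sum_eq_add]; omega)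
  rw [leftFactor, norm_div, Complex.norm_real, Real.norm_of_nonneg (tailRoot_nonneg _ _)]
  rcases (tailRoot_nonneg c (∑ i, (α ∘ Sum.inr) i)).eq_or_lt with h0 | h0
  · rw [← h0, div_zero]
    exact Real.sqrt_nonneg _
  · rw [div_le_iff₀ h0]
    calc ‖c α‖ = Real.sqrt ‖c α‖ * Real.sqrt ‖c α‖ := (Real.mul_self_sqrt (norm_nonneg _)).symm
      _ ≤ _ := by gcongr

lemma leftFactor_mul (hr : 0 < r) (h : HasDecay s r c) (α : κ ⊕ κ → ℕ) :
    leftFactor c α * (tailRoot c (∑ i, (α ∘ Sum.inr) i) : ℂ) = c α := by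
  have h1 : Real.sqrt ‖c α‖ ≤ tailRoot c (∑ i, (α ∘ Sum.inr) i) :=
    sqrt_le_tailRoot hr h (by rw [sum_eq_add]; omega)
  rcases (tailRoot_nonneg c (∑ i, (α ∘ Sum.inr) i)).eq_or_lt with h0 | h0
  -- A vanishing denominator forces `c α = 0`, so division by zero costs nothing.
  · rw [← h0, Real.sqrt_le_left le_rfl, zero_pow two_ne_zero, norm_le_zero_iff] at h1
    rw [← h0, h1, Complex.ofReal_zero, mul_zero]
  · rw [leftFactor, div_mul_cancel₀]
    exact_mod_cast h0.ne'

lemma hasDecay_leftFactor (hr : 0 < r) (h : HasDecay s r c) :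
    HasDecay s (1 / 2 * r) (leftFactor c) := by
  obtain ⟨C, hC, h'⟩ := h.exists_sqrt_le
  refine ⟨C, fun α => ((norm_leftFactor_le hr h α).trans (h' α)).trans (le_of_eq ?_)⟩
  ring_nf

/-- One `1 / 2` comes from the square root; the factor `(1 / 2) ^ (1 / (2 * s))` comes from `|α| =
2|γ|` at a diagonal index `α = (γ, γ)`. -/
lemma hasDecay_rightFactor (hs : 0 < s) (hr : 0 < r) (h : HasDecay s r c) :
    HasDecay s (1 / 2 * (1 / 2) ^ (1 / (2 * s)) * r) (rightFactor c) := by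
  obtain ⟨C, hC, h'⟩ := tailRoot_le hs hr h
  refine ⟨C, fun α => ?_⟩
  rw [rightFactor]
  split_ifs with hα
  · rw [Complex.norm_real, Real.norm_of_nonneg (tailRoot_nonneg _ _)]
    refine (h' _).trans (le_of_eq ?_)
    rw [sum_eq_add α, hα, Nat.cast_add, ← two_mul, Real.mul_rpow (by positivity) (by positivity),
      Real.div_rpow (by positivity) (by positivity), Real.one_rpow]
    have : (0 : ℝ) < 2 ^ (1 / (2 * s)) := by positivity
    congr 2
    field_simp
  · rw [norm_zero]
    positivity

end Factorization

/-! ### A common framework for the Roumieu and Beurling cases. -/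

section DecayClass

variable {ι : Type*} [Fintype ι] [DecidableEq ι]

/-- A class of coefficient families, cut out by a condition on the admissible rates of decay,
whose Hermite series are stable under invertible linear changes of variables. -/
structure IsDecayClass (s : ℝ) (𝒞 : Set ((ι → ℕ) → ℂ)) : Prop where
  exists_hasDecay : ∀ c ∈ 𝒞, ∃ r : ℝ, 0 < r ∧ HasDecay s r c
  -- The loss `ρ` does not depend on `r`, so it is harmless both for "some `r`" and for "every `r`".
  of_rate : ∀ c ∈ 𝒞, ∀ (c' : (ι → ℕ) → ℂ) (ρ : ℝ), 0 < ρ →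
    (∀ r : ℝ, 0 < r → HasDecay s r c → HasDecay s (ρ * r) c') → c' ∈ 𝒞
  comp_mulVec : ∀ c ∈ 𝒞, ∀ f : (ι → ℝ) → ℂ, IsHermiteSeries c f → ∀ B B' : Matrix ι ι ℝ,
    B' * B = 1 → ∃ c' ∈ 𝒞, IsHermiteSeries c' (fun x => f (B.mulVec x))

lemma isDecayClass_roumieu {s : ℝ} (hs : 1 / 2 ≤ s) :
    IsDecayClass s {c : (ι → ℕ) → ℂ | ∃ r : ℝ, 0 < r ∧ HasDecay s r c} where
  exists_hasDecay _ hc := hc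
  of_rate := by
    rintro c ⟨r, hr, hc⟩ c' ρ hρ h
    exact ⟨ρ * r, by positivity, h r hr hc⟩
  comp_mulVec c hc f hf B B' hB := comp_mulVec_mem_roumieu hB hs ⟨c, hc, hf⟩

lemma isDecayClass_beurling {s : ℝ} (hs : 1 / 2 < s) :
    IsDecayClass s {c : (ι → ℕ) → ℂ | ∀ r : ℝ, 0 < r → HasDecay s r c} where
  exists_hasDecay _ hc := ⟨1, one_pos, hc 1 one_pos⟩
  of_rate := by
    intro c hc c' ρ hρ h r hr
    have := h (r / ρ) (by positivity) (hc _ (by positivity))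
    rwa [mul_div_cancel₀ _ hρ.ne'] at this
  comp_mulVec c hc f hf B B' hB := comp_mulVec_mem_beurling hB hs ⟨c, hc, hf⟩

variable {s : ℝ} {𝒞 : Set ((ι → ℕ) → ℂ)}

lemma IsDecayClass.summable (h𝒞 : IsDecayClass s 𝒞) (hs : 0 < s) {c : (ι → ℕ) → ℂ} (hc : c ∈ 𝒞) :
    Summable fun α => ‖c α‖ * weight α := by
  obtain ⟨r, hr, h⟩ := h𝒞.exists_hasDecay c hc
  simpa using h.summable hs hr 1

lemma IsDecayClass.of_norm_le (h𝒞 : IsDecayClass s 𝒞) {c c' : (ι → ℕ) → ℂ} (hc : c ∈ 𝒞) {M : ℝ}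
    (hM : 0 ≤ M) (h : ∀ α, ‖c' α‖ ≤ M * ‖c α‖) : c' ∈ 𝒞 := by
  refine h𝒞.of_rate c hc c' 1 one_pos fun r _ ⟨C, hC⟩ => ⟨M * C, fun α => (h α).trans ?_⟩
  rw [one_mul, mul_assoc]
  exact mul_le_mul_of_nonneg_left (hC α) hM

end DecayClass

/-! ### Correspondence of symbols and kernels, and the factorization. -/

section Main

variable {d : ℕ} {s : ℝ} {𝒞 : Set ((Fin d ⊕ Fin d → ℕ) → ℂ)}

/-- Every operator with symbol in the class has a kernel in the class. -/
lemma IsDecayClass.exists_kernel (h𝒞 : IsDecayClass s 𝒞) (hs : 0 < s)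
    (A : Matrix (Fin d) (Fin d) ℝ) {c : (Fin d ⊕ Fin d → ℕ) → ℂ} (hc : c ∈ 𝒞)
    {a : (Fin d ⊕ Fin d → ℝ) → ℂ} (ha : IsHermiteSeries c a) :
    ∃ c' ∈ 𝒞, ∃ K : (Fin d ⊕ Fin d → ℝ) → ℂ, IsHermiteSeries c' K ∧
      ∀ f x, Op A a f x = ∫ y, K (Sum.elim x y) * f y := by
  have ht : twist c ∈ 𝒞 := h𝒞.of_norm_le hc zero_le_one fun α => by rw [norm_twist, one_mul]
  have hb := isHermiteSeries_tsum (h𝒞.summable hs ht)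
  obtain ⟨c', hc', hK⟩ := h𝒞.comp_mulVec _ ht _ hb (kernelMatrix A) (kernelMatrixInv A)
    (kernelMatrixInv_mul A)
  refine ⟨_, h𝒞.of_norm_le hc' (norm_nonneg (kernelConst d)) fun α => (norm_mul _ _).le, _,
    hK.const_mul (kernelConst d), fun f x => ?_⟩
  exact Op_eq_integral (h𝒞.summable hs hc) ha hb A f x

/-- Every kernel in the class comes from a symbol in the class. -/
lemma IsDecayClass.exists_symbol (h𝒞 : IsDecayClass s 𝒞) (hs : 0 < s)
    (A : Matrix (Fin d) (Fin d) ℝ) {c : (Fin d ⊕ Fin d → ℕ) → ℂ} (hc : c ∈ 𝒞)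
    {K : (Fin d ⊕ Fin d → ℝ) → ℂ} (hK : IsHermiteSeries c K) :
    ∃ c' ∈ 𝒞, ∃ a : (Fin d ⊕ Fin d → ℝ) → ℂ, IsHermiteSeries c' a ∧
      ∀ f x, Op A a f x = ∫ y, K (Sum.elim x y) * f y := by
  have hinv := kernelMatrixInv_mul A
  -- The construction of the kernel is undone in reverse: the linear map, the constant, then the
  -- partial Fourier transform.
  obtain ⟨c₁, hc₁, hb₁⟩ := h𝒞.comp_mulVec c hc K hK (kernelMatrixInv A) (kernelMatrix A)
    (mul_eq_one_comm.1 hinv)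
  have hb := hb₁.const_mul (kernelConst d)⁻¹
  set c₂ := fun α => (kernelConst d)⁻¹ * c₁ α
  have hc₂ : c₂ ∈ 𝒞 := h𝒞.of_norm_le hc₁ (norm_nonneg (kernelConst d)⁻¹)
    fun α => (norm_mul _ _).le
  have hu : untwist c₂ ∈ 𝒞 := h𝒞.of_norm_le hc₂ zero_le_one fun α => by rw [norm_untwist, one_mul]
  refine ⟨_, hu, _, isHermiteSeries_tsum (h𝒞.summable hs hu), fun f x => ?_⟩
  rw [Op_eq_integral (h𝒞.summable hs hu) (isHermiteSeries_tsum (h𝒞.summable hs hu))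
    (by rw [twist_untwist]; exact hb) A f x]
  congr 1
  ext y
  rw [Matrix.mulVec_mulVec, hinv, Matrix.one_mulVec, ← mul_assoc,
    mul_inv_cancel₀ (kernelConst_ne_zero d), one_mul]

/-- Factorization of symbols in a decay class. -/
lemma IsDecayClass.exists_isSharp (h𝒞 : IsDecayClass s 𝒞) (hs : 0 < s)
    (A : Matrix (Fin d) (Fin d) ℝ) {c : (Fin d ⊕ Fin d → ℕ) → ℂ} (hc : c ∈ 𝒞)
    {a : (Fin d ⊕ Fin d → ℝ) → ℂ} (ha : IsHermiteSeries c a) :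
    ∃ a₁, (∃ c₁ ∈ 𝒞, IsHermiteSeries c₁ a₁) ∧ ∃ a₂, (∃ c₂ ∈ 𝒞, IsHermiteSeries c₂ a₂) ∧
      IsSharp A a a₁ a₂ := by
  obtain ⟨k, hk, K, hK, hKa⟩ := h𝒞.exists_kernel hs A hc ha
  obtain ⟨r, hr, hkr⟩ := h𝒞.exists_hasDecay k hk
  have hl : leftFactor k ∈ 𝒞 := h𝒞.of_rate k hk _ (1 / 2) (by norm_num)
    fun r hr h => hasDecay_leftFactor hr h
  have hrt : rightFactor k ∈ 𝒞 := h𝒞.of_rate k hk _ (1 / 2 * (1 / 2) ^ (1 / (2 * s)))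
    (by positivity) fun r hr h => hasDecay_rightFactor hs hr h
  have hK₁ := isHermiteSeries_tsum (h𝒞.summable hs hl)
  have hK₂ := isHermiteSeries_tsum (h𝒞.summable hs hrt)
  obtain ⟨c₁, hc₁, a₁, ha₁, hOp₁⟩ := h𝒞.exists_symbol hs A hl hK₁
  obtain ⟨c₂, hc₂, a₂, ha₂, hOp₂⟩ := h𝒞.exists_symbol hs A hrt hK₂
  refine ⟨a₁, ⟨c₁, hc₁, ha₁⟩, a₂, ⟨c₂, hc₂, ha₂⟩, fun f => funext fun x => ?_⟩
  rw [hKa, hOp₁]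
  simp_rw [hOp₂]
  exact integral_kernel_comp hK₁ hK₂ hK (h𝒞.summable hs hl) (h𝒞.summable hs hrt)
    (h𝒞.summable hs hk) (e := fun γ => (tailRoot k (∑ i, γ i) : ℂ))
    (fun γ => by simp [rightFactor]) (fun α hα => by simp [rightFactor, hα])
    (fun α => leftFactor_mul hr hkr α) f.integrable x

end Main

end Pilipovic

theorem theorem3p6 {d : ℕ} (A : Matrix (Fin d) (Fin d) ℝ) (s₁ s₂ : ℝ)
    (hs₁ : 1 / 2 ≤ s₁) (hs₂ : 1 / 2 < s₂) :
    (∀ a ∈ Pilipovic.roumieu (Fin d ⊕ Fin d) s₁,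
      ∃ a₁ ∈ Pilipovic.roumieu (Fin d ⊕ Fin d) s₁, ∃ a₂ ∈ Pilipovic.roumieu (Fin d ⊕ Fin d) s₁,
        Pilipovic.IsSharp A a a₁ a₂) ∧
    (∀ a ∈ Pilipovic.beurling (Fin d ⊕ Fin d) s₂,
      ∃ a₁ ∈ Pilipovic.beurling (Fin d ⊕ Fin d) s₂, ∃ a₂ ∈ Pilipovic.beurling (Fin d ⊕ Fin d) s₂,
        Pilipovic.IsSharp A a a₁ a₂) := by
  refine ⟨fun a ⟨c, hc, ha⟩ => ?_, fun a ⟨c, hc, ha⟩ => ?_⟩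
  · exact (Pilipovic.isDecayClass_roumieu hs₁).exists_isSharp (by linarith) A hc ha
  · exact (Pilipovic.isDecayClass_beurling hs₂).exists_isSharp (by linarith) A hc ha
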